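/- Let $5\le k\le\infty$, and let $\mathcal F^k$ be the set of $C^k$ functions $f:[-1,1]\to\mathbb R$ with $f'>0$ on $[-1,1]$ (increasing $C^k$ diffeomorphisms onto their image), with the $C^k$ topology (uniform convergence of all derivatives of finite order $\le k$). For $f\in\mathcal F^k$ put $$\varphi_0(y,p,q)=-py+q-f\!\left(-\tfrac1p f(y)+\tfrac qp\right),\qquad p>0,\quad y\in(-1,1),\quad -\tfrac1pf(y)+\tfrac qp\in(-1,1),$$ let the horizon of the surface $\varphi_0=0$ be the set of points of this domain with $\varphi_0=\partial\varphi_0/\partial y=0$, let the apparent contour $\Lambda_0$ be its image under $(y,p,q)\mapsto(p,q)$, let $L_0(y)=(f'(y),\,f'(y)y+f(y))$, and let $$A=\Big\{y\in(-1,1):\ \frac{\partial^3\varphi_0}{\partial y^3}\big(y,L_0(y)\big)=0\Big\}$$ be the set of codimension-2 flip points. Let $G(y,p,q)=py+qy^3-y^5$ on $\mathbb R^3$, and let $\Lambda_G$ be its apparent contour, the set of $(p,q)$ such that $G=\partial G/\partial y=0$ at $(y,p,q)$ for some $y$, that is, $\Lambda_G=\{p=0\}\cup\{p=-q^2/4,\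 q\ge0\}$ (this is also the apparent contour of $G/y=p+qy^2-y^4$). Then for generic $f$, i.e. for all $f$ in a residual subset of $\mathcal F^k$, the following holds. For every $y_0\in A$ there is a local $C^1$ diffeomorphism $h$ of the $(p,q)$-plane, defined near $L_0(y_0)$, with $h(L_0(y_0))=(0,0)$, which maps the germ of $\Lambda_0$ at $L_0(y_0)$ onto the germ of $\Lambda_G$ at $(0,0)$ and the germ of the curve $L_0$ onto the germ of the line $p=0$. Moreover, for every neighbourhood $U$ of $y_0$, the apparent contour of the part of the surface lying over $y\in U$ has the same germ at $L_0(y_0)$ as $\Lambda_0$. -/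

import Mathlib

open Set Filter Topology

/-- The increasing `C^k` diffeomorphisms `f : [-1, 1] → f([-1, 1]) ⊆ ℝ`, that is, the `C^k` functions
on `[-1, 1]` with positive derivative. Only the restriction of `toFun` to `[-1, 1]` matters. -/
structure SectionMap (k : ℕ∞) where
  toFun : ℝ → ℝ
  contDiffOn : ContDiffOn ℝ k toFun (Icc (-1) 1)
  deriv_pos : ∀ y ∈ Icc (-1 : ℝ) 1, 0 < derivWithin toFun (Icc (-1) 1) y

/-- The derivatives of order `j ≤ k`, `j < ∞`, of `f` on `[-1, 1]`, with the topology of uniform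
convergence on `[-1, 1]`. -/
noncomputable def SectionMap.derivs {k : ℕ∞} (f : SectionMap k) :
    {j : ℕ // (j : ℕ∞) ≤ k} → UniformFun (Icc (-1 : ℝ) 1) ℝ :=
  fun j => UniformFun.ofFun fun y => iteratedDerivWithin j f.toFun (Icc (-1) 1) y

/-- The `C^k` topology on `[-1, 1]`: uniform convergence of all derivatives of finite order `≤ k`. -/
noncomputable instance SectionMap.instTopologicalSpace (k : ℕ∞) :
    TopologicalSpace (SectionMap k) :=
  TopologicalSpace.induced SectionMap.derivs inferInstance

/-- The horizon of the surface `φ = 0` inside the open domain `D`: the points `(y, p, q)` of `D` with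
`φ (y, p, q) = 0` and `∂φ/∂y (y, p, q) = 0`. -/
def horizon (D : Set (ℝ × ℝ × ℝ)) (φ : ℝ → ℝ → ℝ → ℝ) : Set (ℝ × ℝ × ℝ) :=
  {x | x ∈ D ∧ φ x.1 x.2.1 x.2.2 = 0 ∧ deriv (fun y => φ y x.2.1 x.2.2) x.1 = 0}

/-- The apparent contour of the part of the surface `φ = 0` that lies over `y ∈ U`: the projection
to the `(p, q)`-plane of the points of the horizon with `y ∈ U`. The whole apparent contour is
the case `U = univ`. -/
def apparentContour (D : Set (ℝ × ℝ × ℝ)) (φ : ℝ → ℝ → ℝ → ℝ) (U : Set ℝ) : Set (ℝ × ℝ) :=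
  {x | ∃ y ∈ U, (y, x.1, x.2) ∈ horizon D φ}

/-- `φ₀ (y, p, q) = -p y + q - f (-f(y)/p + q/p)`. -/
noncomputable def phiZero (f : ℝ → ℝ) (y p q : ℝ) : ℝ :=
  -p * y + q - f (-(1 / p) * f y + q / p)

/-- The interior of the domain of `φ₀` when `f` is defined on `[-1, 1]`. -/
def phiZeroDomain (f : ℝ → ℝ) : Set (ℝ × ℝ × ℝ) :=
  {x | 0 < x.2.1 ∧ x.1 ∈ Ioo (-1 : ℝ) 1 ∧ -(1 / x.2.1) * f x.1 + x.2.2 / x.2.1 ∈ Ioo (-1 : ℝ) 1}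

/-- The curve `L₀ (y) = (f'(y), f'(y) y + f(y))`. -/
noncomputable def curveLZero (f : ℝ → ℝ) (y : ℝ) : ℝ × ℝ :=
  (deriv f y, deriv f y * y + f y)

/-- The set `A` of codimension-2 flips: the `y` at which `∂³φ₀/∂y³` vanishes at `(y, L₀ (y))`. -/
def flipSet (f : ℝ → ℝ) : Set ℝ :=
  {y | y ∈ Ioo (-1 : ℝ) 1 ∧
    iteratedDeriv 3 (fun z => phiZero f z (curveLZero f y).1 (curveLZero f y).2) y = 0}

/-- The model `G (y, p, q) = p y + q y³ - y⁵`. -/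
def flipModel (y p q : ℝ) : ℝ := p * y + q * y ^ 3 - y ^ 5

/-!
Put `T(x) = (q - f(x)) / p`. The equations of the horizon of `φ₀ = 0` at `(y, p, q)` say that `y`
is a fixed point of `T ∘ T` of multiplier `1` (`mem_apparentContour_phiZero`,
`IsDegenerateCycle`): with `z = T(y)` they read `f(y) + p z = q`, `f(z) + p y = q`, `f'(y) f'(z) =
p²`. The solutions with `y = z` are the flips, with parameters on `L₀`; the others are degenerate
2-cycles. The codimension-2 flips are the zeros of the Schwarzian derivative of `f`, that is, of
`N = 2 f' f''' - 3 f''²` (`schwarzian_eq_zero_of_mem_flipSet`).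

**Normal form.** Write a 2-cycle as `y = m + t`, `z = m - t`. After division by the powers of `t`
that symmetry produces, the equations become equations between weighted averages of derivatives of
`f` over `[m - t, m + t]` (`wAvg`), and if `N(y₀) = 0 ≠ N'(y₀)` they define a `C¹` curve `m =
M(t)` through `(0, y₀)` (`IsJet.exists_foldCurve`). Let `R = q - y₀ p`. Near `y₀` the value of `R`
parametrizes `L₀` as `p = φ(R)`, and on the curve of 2-cycles `R` is a `C¹` function of `t²` with
nonzero derivative, while `p - φ(R)` is asymptotic to `κ t⁴`, where `κ ≠ 0`; both hold if the
fifth order expression `flipFoldNum` does not vanish (`IsJet.exists_foldCurve_normalForm`).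
Consequently there are a constant `α = ± 1` and a `C¹` diffeomorphism `Q` of the line such that
`h(p, q) = (α (p - φ(R)), Q(R))` maps the curve of 2-cycles onto `p = -q² / 4`, `q > 0`, and `L₀`
onto `p = 0`. For `Q`, one has to take the square root of `-4 α (p - φ(R))`, which along the curve
is a `C¹` function of `t²` (`exists_contDiffAt_comp_sq`). If no other degenerate cycle of `f` has
the parameters `L₀(y₀)`, compactness confines the degenerate cycles of nearby parameters to a
small neighbourhood of `y₀`, so that the local picture is the whole apparent contour
(`exists_flip_normalForm`).

**Genericity.** Three conditions are used: the zeros of `N` are simple, `flipFoldNum` does not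
vanish at them, and no codimension-2 flip shares its parameters with another degenerate cycle.
Each is a countable intersection of conditions that are open by compactness of `[-1, 1]`. For
density of the first two, perturb `f` by polynomials of degree five: the bad coefficients are a
differentiable image of a null set (`exists_null_set_of_degenerateFlip`). For the third, the
parameters having a degenerate 2-cycle are critical values of a map of the plane, hence a null set
by Sard's lemma in equal dimensions (`volume_degenerateCycles_eq_zero`); replacing `f` by `(1 + δ)
f + ε` near a flip moves its parameters arbitrarily and leaves the distant cycles alone
(`exists_local_rescaling`).
-/

/-! ### Weighted symmetric averages -/

/-- The average `∫_{-1}^{1} w(s) G(m + t s) ds` of `G` over `[m - t, m + t]` with weight `w`, as a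
function of the pair `(t, m)`. -/
noncomputable def wAvg (w G : ℝ → ℝ) (v : ℝ × ℝ) : ℝ :=
  ∫ s in (-1 : ℝ)..1, w s * G (v.2 + v.1 * s)

lemma continuous_wAvg {w G : ℝ → ℝ} (hw : Continuous w) (hG : Continuous G) :
    Continuous (wAvg w G) := by
  unfold wAvg
  apply intervalIntegral.continuous_parametric_intervalIntegral_of_continuous'
  simp only [Function.uncurry_def]
  fun_prop

lemma wAvg_zero (w G : ℝ → ℝ) (m : ℝ) :
    wAvg w G (0, m) = (∫ s in (-1 : ℝ)..1, w s) * G m := by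
  simp [wAvg]

/-- Differentiation under the integral sign for a jointly continuous derivative. -/
lemma hasDerivAt_intervalIntegral_param {F F' : ℝ → ℝ → ℝ} {a b : ℝ}
    (hF : ∀ x, Continuous (F x)) (hF' : Continuous (Function.uncurry F'))
    (hd : ∀ x s, HasDerivAt (fun x => F x s) (F' x s) x) (x₀ : ℝ) :
    HasDerivAt (fun x => ∫ s in a..b, F x s) (∫ s in a..b, F' x₀ s) x₀ := by
  obtain ⟨C, hC⟩ := ((isCompact_closedBall x₀ 1).prod isCompact_uIcc).exists_bound_of_continuousOn
    (f := Function.uncurry F') (s := Metric.closedBall x₀ 1 ×ˢ uIcc a b) hF'.continuousOn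
  refine (intervalIntegral.hasDerivAt_integral_of_dominated_loc_of_deriv_le
    (bound := fun _ => C) (Metric.ball_mem_nhds x₀ one_pos)
    (Eventually.of_forall fun x => (hF x).aestronglyMeasurable)
    ((hF x₀).intervalIntegrable _ _) ?_ ?_ ?_ ?_).2
  · exact (hF'.comp (Continuous.prodMk_right x₀)).aestronglyMeasurable
  · refine Eventually.of_forall fun s hs x hx => ?_
    exact hC (x, s) ⟨Metric.ball_subset_closedBall hx, uIoc_subset_uIcc hs⟩
  · exact intervalIntegrable_const
  · exact Eventually.of_forall fun s _ x _ => hd x s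

lemma hasStrictFDerivAt_wAvg {w G G' : ℝ → ℝ} (hw : Continuous w)
    (hG : ∀ x, HasDerivAt G (G' x) x) (hG' : Continuous G') (v : ℝ × ℝ) :
    HasStrictFDerivAt (wAvg w G)
      (wAvg (fun s => s * w s) G' v • ContinuousLinearMap.fst ℝ ℝ ℝ +
        wAvg w G' v • ContinuousLinearMap.snd ℝ ℝ ℝ) v := by
  have hGc : Continuous G := continuous_iff_continuousAt.2 fun x => (hG x).continuousAt
  have key := hasStrictFDerivAt_uncurry_coprod (𝕜 := ℝ) (u := v)
    (f := fun t m => wAvg w G (t, m))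
    (f₁ := fun t m => wAvg (fun s => s * w s) G' (t, m) • ContinuousLinearMap.id ℝ ℝ)
    (f₂ := fun t m => wAvg w G' (t, m) • ContinuousLinearMap.id ℝ ℝ) ?_ ?_ ?_ ?_
  · convert! key using 1
  · refine Eventually.of_forall fun u => ?_
    have : HasDerivAt (fun t => wAvg w G (t, u.2)) (wAvg (fun s => s * w s) G' (u.1, u.2)) u.1 := by
      unfold wAvg
      refine hasDerivAt_intervalIntegral_param
        (F' := fun t s => s * w s * G' (u.2 + t * s)) (by fun_prop)
        (by simp only [Function.uncurry_def]; fun_prop) (fun t s => ?_) _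
      have h1 : HasDerivAt (fun t => u.2 + t * s) s t := by
        simpa using ((hasDerivAt_id t).mul_const s).const_add u.2
      convert! ((hG (u.2 + t * s)).comp t h1).const_mul (w s) using 1
      ring
    convert! this.hasFDerivAt using 1
    ext; simp [Function.HasUncurry.uncurry]
  · refine Eventually.of_forall fun u => ?_
    have : HasDerivAt (fun m => wAvg w G (u.1, m)) (wAvg w G' (u.1, u.2)) u.2 := by
      unfold wAvg
      refine hasDerivAt_intervalIntegral_param
        (F' := fun m s => w s * G' (m + u.1 * s)) (by fun_prop)
        (by simp only [Function.uncurry_def]; fun_prop) (fun m s => ?_) _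
      have h1 : HasDerivAt (fun m => m + u.1 * s) 1 m := (hasDerivAt_id m).add_const _
      convert! ((hG (m + u.1 * s)).comp m h1).const_mul (w s) using 1
      ring
    convert! this.hasFDerivAt using 1
    ext; simp [Function.HasUncurry.uncurry]
  · have := continuous_wAvg (w := fun s => s * w s) (by fun_prop) hG'
    exact (Continuous.smul (f := fun v : ℝ × ℝ => wAvg (fun s => s * w s) G' v) this
      continuous_const).continuousAt
  · exact (Continuous.smul (f := fun v : ℝ × ℝ => wAvg w G' v) (continuous_wAvg hw hG')
      continuous_const).continuousAt

/-- Integration by parts: if `W' = -s w` and `W` vanishes at `±1`, the average of `G'` with the odd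
weight `s w` is `t` times the average of `G''` with weight `W`. -/
lemma wAvg_odd_eq {w W G' G'' : ℝ → ℝ} (hw : Continuous w)
    (hW : ∀ s, HasDerivAt W (-(s * w s)) s) (hW1 : W 1 = 0) (hW2 : W (-1) = 0)
    (hG' : ∀ x, HasDerivAt G' (G'' x) x) (hG'' : Continuous G'') (v : ℝ × ℝ) :
    wAvg (fun s => s * w s) G' v = v.1 * wAvg W G'' v := by
  have hWc : Continuous W := continuous_iff_continuousAt.2 fun x => (hW x).continuousAt
  have hGc : Continuous G' := continuous_iff_continuousAt.2 fun x => (hG' x).continuousAt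
  have hd : ∀ s ∈ uIcc (-1 : ℝ) 1, HasDerivAt (fun s => W s * G' (v.2 + v.1 * s))
      (v.1 * (W s * G'' (v.2 + v.1 * s)) - s * w s * G' (v.2 + v.1 * s)) s := by
    intro s _
    have h1 : HasDerivAt (fun s => v.2 + v.1 * s) v.1 s := by
      simpa using ((hasDerivAt_id s).const_mul v.1).const_add v.2
    convert! (hW s).mul ((hG' (v.2 + v.1 * s)).comp s h1) using 1
    simp only [Function.comp_apply]; ring
  have := intervalIntegral.integral_eq_sub_of_hasDerivAt hd
    ((by fun_prop : Continuous fun s => v.1 * (W s * G'' (v.2 + v.1 * s)) -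
      s * w s * G' (v.2 + v.1 * s)).intervalIntegrable _ _)
  rw [intervalIntegral.integral_sub
    ((by fun_prop : Continuous fun s => v.1 * (W s * G'' (v.2 + v.1 * s))).intervalIntegrable _ _)
    ((by fun_prop : Continuous fun s => s * w s * G' (v.2 + v.1 * s)).intervalIntegrable _ _),
    intervalIntegral.integral_const_mul, hW1, hW2] at this
  simp only [wAvg]
  linarith

lemma hasStrictFDerivAt_wAvg_even {w W G G' G'' : ℝ → ℝ} (hw : Continuous w)
    (hW : ∀ s, HasDerivAt W (-(s * w s)) s) (hW1 : W 1 = 0) (hW2 : W (-1) = 0)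
    (hG : ∀ x, HasDerivAt G (G' x) x) (hG' : ∀ x, HasDerivAt G' (G'' x) x)
    (hG'' : Continuous G'') (v : ℝ × ℝ) :
    HasStrictFDerivAt (wAvg w G)
      ((v.1 * wAvg W G'' v) • ContinuousLinearMap.fst ℝ ℝ ℝ +
        wAvg w G' v • ContinuousLinearMap.snd ℝ ℝ ℝ) v := by
  rw [← wAvg_odd_eq hw hW hW1 hW2 hG' hG'']
  exact hasStrictFDerivAt_wAvg hw hG
    (continuous_iff_continuousAt.2 fun x => (hG' x).continuousAt) v

/-- The weight of the ordinary mean. -/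
noncomputable def wZero (_ : ℝ) : ℝ := 1 / 2

/-- The weight obtained from `wZero` by one integration by parts. -/
noncomputable def wOne (s : ℝ) : ℝ := (1 - s ^ 2) / 4

/-- The weight obtained from `wOne` by one integration by parts. -/
noncomputable def wTwo (s : ℝ) : ℝ := (1 - s ^ 2) ^ 2 / 16

lemma continuous_wZero : Continuous wZero := continuous_const

lemma continuous_wOne : Continuous wOne := by unfold wOne; fun_prop

lemma continuous_wTwo : Continuous wTwo := by unfold wTwo; fun_prop

lemma hasDerivAt_wOne (s : ℝ) : HasDerivAt wOne (-(s * wZero s)) s := by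
  unfold wOne wZero
  convert! (((hasDerivAt_id s).pow 2).const_sub 1).div_const 4 using 1
  simp; ring

lemma hasDerivAt_wTwo (s : ℝ) : HasDerivAt wTwo (-(s * wOne s)) s := by
  unfold wTwo wOne
  convert! ((((hasDerivAt_id s).pow 2).const_sub 1).pow 2).div_const 16 using 1
  simp; ring

lemma integral_wZero : ∫ s in (-1 : ℝ)..1, wZero s = 1 := by
  norm_num [wZero]

lemma integral_wOne : ∫ s in (-1 : ℝ)..1, wOne s = 1 / 3 := by
  simp only [wOne, intervalIntegral.integral_div]
  rw [intervalIntegral.integral_sub (by simp) (by simp)]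
  norm_num [integral_pow]

lemma integral_wTwo : ∫ s in (-1 : ℝ)..1, wTwo s = 1 / 15 := by
  have : ∀ s : ℝ, HasDerivAt (fun s : ℝ => (s - 2 * s ^ 3 / 3 + s ^ 5 / 5) / 16) (wTwo s) s := by
    intro s
    unfold wTwo
    convert! (((hasDerivAt_id s).sub ((((hasDerivAt_id s).pow 3).const_mul 2).div_const 3)).add
      (((hasDerivAt_id s).pow 5).div_const 5)).div_const 16 using 1
    simp; ring
  rw [intervalIntegral.integral_eq_sub_of_hasDerivAt (fun s _ => this s)
    (continuous_wTwo.intervalIntegrable _ _)]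
  norm_num

lemma wAvg_wZero_eq {G G' : ℝ → ℝ} (hG : ∀ x, HasDerivAt G (G' x) x) (hG' : Continuous G')
    (t m : ℝ) : 2 * t * wAvg wZero G' (t, m) = G (m + t) - G (m - t) := by
  have hd : ∀ s ∈ uIcc (-1 : ℝ) 1, HasDerivAt (fun s => G (m + t * s))
      (2 * t * (wZero s * G' (m + t * s))) s := by
    intro s _
    have h1 : HasDerivAt (fun s => m + t * s) t s := by
      simpa using ((hasDerivAt_id s).const_mul t).const_add m
    convert! (hG (m + t * s)).comp s h1 using 1
    simp [wZero]; ring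
  have := intervalIntegral.integral_eq_sub_of_hasDerivAt hd
    ((by unfold wZero; fun_prop : Continuous fun s =>
      2 * t * (wZero s * G' (m + t * s))).intervalIntegrable _ _)
  rw [intervalIntegral.integral_const_mul] at this
  simpa [wAvg, sub_eq_add_neg] using this

/-- The trapezoidal rule with its remainder: the mean of the two end values is the mean over the
interval plus `t²` times an average of the second derivative. -/
lemma add_eq_wAvg {G G' G'' : ℝ → ℝ} (hG : ∀ x, HasDerivAt G (G' x) x)
    (hG' : ∀ x, HasDerivAt G' (G'' x) x) (hG'' : Continuous G'') (t m : ℝ) :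
    G (m + t) + G (m - t) = 2 * (wAvg wZero G (t, m) + t ^ 2 * wAvg wOne G'' (t, m)) := by
  have hGc : Continuous G := continuous_iff_continuousAt.2 fun x => (hG x).continuousAt
  have hGc' : Continuous G' := continuous_iff_continuousAt.2 fun x => (hG' x).continuousAt
  have hd : ∀ s ∈ uIcc (-1 : ℝ) 1, HasDerivAt (fun s => s * G (m + t * s))
      (2 * (wZero s * G (m + t * s)) + 2 * t * (s * wZero s * G' (m + t * s))) s := by
    intro s _
    have h1 : HasDerivAt (fun s => m + t * s) t s := by
      simpa using ((hasDerivAt_id s).const_mul t).const_add m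
    convert! (hasDerivAt_id s).mul ((hG (m + t * s)).comp s h1) using 1
    simp [wZero]; ring
  have c1 : Continuous fun s => 2 * (wZero s * G (m + t * s)) := by unfold wZero; fun_prop
  have c2 : Continuous fun s => 2 * t * (s * wZero s * G' (m + t * s)) := by
    unfold wZero; fun_prop
  have := intervalIntegral.integral_eq_sub_of_hasDerivAt hd
    ((c1.add c2).intervalIntegrable _ _)
  rw [intervalIntegral.integral_add (c1.intervalIntegrable _ _) (c2.intervalIntegrable _ _),
    intervalIntegral.integral_const_mul, intervalIntegral.integral_const_mul] at this
  have h2 := wAvg_odd_eq (v := (t, m)) continuous_wZero hasDerivAt_wOne (by norm_num [wOne])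
    (by norm_num [wOne]) hG' hG''
  simp only [wAvg] at h2 ⊢
  rw [h2] at this
  have e : G (m + t * -1) = G (m - t) := by ring_nf
  rw [e] at this
  simp only [mul_one, one_mul] at this
  linarith

/-! ### Local diffeomorphisms and functions of `t²` -/

/-- The inverse function theorem in the form of a partial homeomorphism that is `C¹` in both
directions. -/
lemma exists_openPartialHomeomorph_contDiffOn {E F : Type*} [NormedAddCommGroup E]
    [NormedSpace ℝ E] [CompleteSpace E] [NormedAddCommGroup F] [NormedSpace ℝ F] {f : E → F}
    {a : E} {f' : E ≃L[ℝ] F} (hf : ContDiffAt ℝ 1 f a) (hf' : HasFDerivAt f (f' : E →L[ℝ] F) a) :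
    ∃ e : OpenPartialHomeomorph E F, a ∈ e.source ∧ ⇑e = f ∧ ContDiffOn ℝ 1 e e.source ∧
      ContDiffOn ℝ 1 e.symm e.target := by
  set e₀ := hf.toOpenPartialHomeomorph f hf' one_ne_zero with he₀
  have hc : ⇑e₀ = f := rfl
  have ha : a ∈ e₀.source := hf.mem_toOpenPartialHomeomorph_source hf' one_ne_zero
  have hfa : f a ∈ e₀.target := hf.image_mem_toOpenPartialHomeomorph_target hf' one_ne_zero
  have hs : ContDiffAt ℝ 1 e₀.symm (f a) := by
    apply e₀.contDiffAt_symm hfa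
    · rw [← hc, e₀.left_inv ha]; exact hf'
    · rw [← hc, e₀.left_inv ha]; exact hf
  have h1 : ∀ᶠ x in 𝓝 a, ContDiffAt ℝ 1 f x := hf.eventually (by simp)
  have h2 : ∀ᶠ y in 𝓝 (f a), ContDiffAt ℝ 1 e₀.symm y := hs.eventually (by simp)
  have h3 : ∀ᶠ x in 𝓝 a, ContDiffAt ℝ 1 e₀.symm (f x) := hf.continuousAt.eventually h2
  obtain ⟨s, hs, hso, has⟩ := eventually_nhds_iff.1 (h1.and h3)
  refine ⟨e₀.restrOpen s hso, ⟨ha, has⟩, hc, ?_, ?_⟩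
  · intro x hx
    exact (hs x hx.2).1.contDiffWithinAt
  · intro y hy
    have hy1 : y ∈ e₀.target := hy.1
    have hy2 : e₀.symm y ∈ s := hy.2
    have := (hs _ hy2).2
    rw [← hc, e₀.right_inv hy1] at this
    exact this.contDiffWithinAt

lemma exists_openPartialHomeomorph_real {f : ℝ → ℝ} {a f' : ℝ} (hf : ContDiffAt ℝ 1 f a)
    (hf' : HasDerivAt f f' a) (h0 : f' ≠ 0) :
    ∃ e : OpenPartialHomeomorph ℝ ℝ, a ∈ e.source ∧ ⇑e = f ∧ ContDiffOn ℝ 1 e e.source ∧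
      ContDiffOn ℝ 1 e.symm e.target :=
  exists_openPartialHomeomorph_contDiffOn
    (f' := ContinuousLinearEquiv.unitsEquivAut ℝ (Units.mk0 f' h0)) hf (by
      convert! hf'.hasFDerivAt using 1)

lemma contDiffAt_one_of_hasDerivAt {f f' : ℝ → ℝ} {a : ℝ}
    (h : ∀ᶠ x in 𝓝 a, HasDerivAt f (f' x) x ∧ ContinuousAt f' x) : ContDiffAt ℝ 1 f a := by
  obtain ⟨s, hs, hso, has⟩ := eventually_nhds_iff.1 h
  have hd : ContDiffOn ℝ 1 f s := by
    rw [show (1 : WithTop ℕ∞) = 0 + 1 by simp, contDiffOn_succ_iff_deriv_of_isOpen hso]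
    refine ⟨fun x hx => (hs x hx).1.differentiableAt.differentiableWithinAt, by simp, ?_⟩
    rw [contDiffOn_zero]
    refine ContinuousOn.congr (f := f') (fun x hx => (hs x hx).2.continuousWithinAt) ?_
    exact fun x hx => (hs x hx).1.deriv
  exact hd.contDiffAt (hso.mem_nhds has)

/-- If the derivative of `a` at small `t > 0` is `2 t g(t)` with `g` continuous and `g(t) → g₀`,
then `a` is a `C¹` function of `t²`, extended linearly to negative arguments. -/
lemma exists_contDiffAt_comp_sq {a g : ℝ → ℝ} {a₀ g₀ : ℝ}
    (ha : ∀ᶠ t in 𝓝[>] (0 : ℝ), HasDerivAt a (2 * t * g t) t ∧ ContinuousAt g t)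
    (ha0 : Tendsto a (𝓝[>] 0) (𝓝 a₀)) (hg0 : Tendsto g (𝓝[>] 0) (𝓝 g₀)) (h0 : a 0 = a₀) :
    ∃ b : ℝ → ℝ, ContDiffAt ℝ 1 b 0 ∧ HasDerivAt b g₀ 0 ∧ ∀ t, 0 ≤ t → b (t ^ 2) = a t := by
  obtain ⟨ε, hε, hεs⟩ := mem_nhdsGT_iff_exists_Ioo_subset.1 ha
  have hε : 0 < ε := hε
  set b : ℝ → ℝ := fun x => if x ≤ 0 then a₀ + g₀ * x else a (√x) with hb
  set b' : ℝ → ℝ := fun x => if x ≤ 0 then g₀ else g (√x) with hb'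
  have hsq : Tendsto Real.sqrt (𝓝[>] 0) (𝓝[>] 0) := by
    refine tendsto_nhdsWithin_iff.2 ⟨?_, ?_⟩
    · have := Real.continuous_sqrt.tendsto 0
      rw [Real.sqrt_zero] at this
      exact this.mono_left nhdsWithin_le_nhds
    · filter_upwards [self_mem_nhdsWithin] with x hx using Real.sqrt_pos.2 hx
  -- continuity at the gluing point
  have glue : ∀ (u v : ℝ → ℝ) (c : ℝ), ContinuousAt u 0 → u 0 = c → Tendsto v (𝓝[>] 0) (𝓝 c) →
      ContinuousAt (fun x => if x ≤ 0 then u x else v (√x)) 0 := by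
    intro u v c hu huc hv
    rw [continuousAt_iff_continuous_left_right]
    constructor
    · refine (hu.continuousWithinAt (s := Iic 0)).congr (fun y hy => ?_) ?_
      · exact if_pos hy
      · simp
    · rw [← continuousWithinAt_Ioi_iff_Ici]
      unfold ContinuousWithinAt
      simp only [le_refl, if_true, huc]
      refine (hv.comp hsq).congr' ?_
      filter_upwards [self_mem_nhdsWithin] with x hx
      simp [not_le.2 (show (0:ℝ) < x from hx)]
  have cb : ContinuousAt b 0 := glue (fun x => a₀ + g₀ * x) a a₀ (by fun_prop) (by simp) ha0
  have cb' : ContinuousAt b' 0 := glue (fun x => g₀) g g₀ (by fun_prop) rfl hg0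
  have hneg : ∀ x < 0, HasDerivAt b (b' x) x ∧ ContinuousAt b' x := by
    intro x hx
    have e : ∀ᶠ y in 𝓝 x, y ≤ 0 := (eventually_lt_nhds hx).mono fun _ h => h.le
    have e1 : b =ᶠ[𝓝 x] fun x => a₀ + g₀ * x := e.mono fun y hy => if_pos hy
    have e2 : b' =ᶠ[𝓝 x] fun x => g₀ := e.mono fun y hy => if_pos hy
    refine ⟨?_, continuousAt_const.congr e2.symm⟩
    rw [e2.eq_of_nhds]
    refine HasDerivAt.congr_of_eventuallyEq ?_ e1
    simpa using ((hasDerivAt_id x).const_mul g₀).const_add a₀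
  have hpos : ∀ x, 0 < x → x < ε ^ 2 → HasDerivAt b (b' x) x ∧ ContinuousAt b' x := by
    intro x hx hxε
    have e : ∀ᶠ y in 𝓝 x, ¬ y ≤ 0 := (eventually_gt_nhds hx).mono fun _ h => not_le.2 h
    have e1 : b =ᶠ[𝓝 x] fun x => a (√x) := e.mono fun y hy => if_neg hy
    have e2 : b' =ᶠ[𝓝 x] fun x => g (√x) := e.mono fun y hy => if_neg hy
    have hs0 : 0 < √x := Real.sqrt_pos.2 hx
    have hs1 : √x < ε := by rw [Real.sqrt_lt' hε]; exact hxε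
    obtain ⟨d, c⟩ := hεs ⟨hs0, hs1⟩
    refine ⟨?_, ContinuousAt.congr ?_ e2.symm⟩
    · rw [e2.eq_of_nhds]
      refine HasDerivAt.congr_of_eventuallyEq ?_ e1
      convert! d.comp x (Real.hasDerivAt_sqrt hx.ne') using 1
      field_simp
    · exact ContinuousAt.comp (g := g) c Real.continuous_sqrt.continuousAt
  have hnear : ∀ᶠ x in 𝓝 (0 : ℝ), x < ε ^ 2 := eventually_lt_nhds (by positivity)
  have hall : ∀ᶠ x in 𝓝 (0 : ℝ), HasDerivAt b (b' x) x ∧ ContinuousAt b' x := by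
    have hz : HasDerivAt b (b' 0) 0 := by
      have hr := hasDerivWithinAt_Ici_of_tendsto_deriv (s := Ioo 0 (ε ^ 2)) (a := 0) (e := b' 0)
        (f := b) (fun x hx => (hpos x hx.1 hx.2).1.differentiableAt.differentiableWithinAt)
        (cb.continuousWithinAt) (Ioo_mem_nhdsGT (by positivity)) (by
          refine ((cb'.tendsto).mono_left (nhdsWithin_le_nhds (s := Ioi 0))).congr' ?_
          filter_upwards [Ioo_mem_nhdsGT (show (0:ℝ) < ε ^ 2 by positivity)] with x hx
          exact (hpos x hx.1 hx.2).1.deriv.symm)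
      have hl := hasDerivWithinAt_Iic_of_tendsto_deriv (s := Iio 0) (a := 0) (e := b' 0)
        (f := b) (fun x hx => (hneg x hx).1.differentiableAt.differentiableWithinAt)
        (cb.continuousWithinAt) self_mem_nhdsWithin (by
          refine ((cb'.tendsto).mono_left (nhdsWithin_le_nhds (s := Iio 0))).congr' ?_
          filter_upwards [self_mem_nhdsWithin] with x hx
          exact (hneg x hx).1.deriv.symm)
      have := (hl.union hr)
      rwa [Iic_union_Ici, hasDerivWithinAt_univ] at this
    filter_upwards [hnear] with x hx
    rcases lt_trichotomy x 0 with h | h | h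
    · exact hneg x h
    · subst h; exact ⟨hz, cb'⟩
    · exact hpos x h hx
  refine ⟨b, contDiffAt_one_of_hasDerivAt hall, ?_, ?_⟩
  · have := hall.self_of_nhds.1
    simpa [hb'] using this
  · intro t ht
    rcases ht.eq_or_lt with h | h
    · simp [hb, ← h, h0]
    · have : ¬ t ^ 2 ≤ 0 := not_le.2 (by positivity)
      simp [hb, this, Real.sqrt_sq ht]

/-! ### The curve of degenerate 2-cycles near a flip -/

/-- `F 0` is a `C⁵` function on `ℝ` and `F 1, …, F 5` are its successive derivatives. -/
structure IsJet (F : ℕ → ℝ → ℝ) : Prop where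
  hasDerivAt : ∀ i < 5, ∀ x, HasDerivAt (F i) (F (i + 1) x) x
  continuous_five : Continuous (F 5)

lemma IsJet.continuous {F : ℕ → ℝ → ℝ} (hF : IsJet F) {i : ℕ} (hi : i ≤ 5) : Continuous (F i) := by
  rcases hi.lt_or_eq with h | rfl
  · exact continuous_iff_continuousAt.2 fun x => (hF.hasDerivAt i h x).continuousAt
  · exact hF.continuous_five

/-- The slope of the chord of `F 0` over `[m - t, m + t]` (the derivative at `m` if `t = 0`), as a
function of `v = (t, m)`. -/
noncomputable def chordSlope (F : ℕ → ℝ → ℝ) (v : ℝ × ℝ) : ℝ := wAvg wZero (F 1) v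

/-- The slope of the chord of `F 1` over `[m - t, m + t]`. -/
noncomputable def chordSlopeDeriv (F : ℕ → ℝ → ℝ) (v : ℝ × ℝ) : ℝ := wAvg wZero (F 2) v

/-- The defect `K` of the trapezoidal rule for `F 1` on `[m - t, m + t]`, divided by `t²`. -/
noncomputable def trapDefect (F : ℕ → ℝ → ℝ) (v : ℝ × ℝ) : ℝ := wAvg wOne (F 3) v

/-- The abbreviation `V = 2 P + t² K` of the chord slope `P` and the trapezoidal defect `K`. -/
noncomputable def slopeSum (F : ℕ → ℝ → ℝ) (v : ℝ × ℝ) : ℝ :=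
  2 * chordSlope F v + v.1 ^ 2 * trapDefect F v

/-- The function `E = K V - J²`: for `t ≠ 0` it vanishes exactly when the 2-cycle
`{m + t, m - t}` of the parameter given by its chord is degenerate; at `t = 0` it is a multiple of
the Schwarzian derivative. -/
noncomputable def foldFn (F : ℕ → ℝ → ℝ) (v : ℝ × ℝ) : ℝ :=
  trapDefect F v * slopeSum F v - chordSlopeDeriv F v ^ 2

/-- The partial derivative of `foldFn` in `t`, divided by `t`. -/
noncomputable def foldFnT (F : ℕ → ℝ → ℝ) (v : ℝ × ℝ) : ℝ :=
  wAvg wTwo (F 5) v * slopeSum F v +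
    trapDefect F v * (4 * trapDefect F v + v.1 ^ 2 * wAvg wTwo (F 5) v) -
    2 * chordSlopeDeriv F v * wAvg wOne (F 4) v

/-- The partial derivative of `foldFn` in `m`. -/
noncomputable def foldFnM (F : ℕ → ℝ → ℝ) (v : ℝ × ℝ) : ℝ :=
  wAvg wOne (F 4) v * slopeSum F v +
    trapDefect F v * (2 * chordSlopeDeriv F v + v.1 ^ 2 * wAvg wOne (F 4) v) -
    2 * chordSlopeDeriv F v * wAvg wZero (F 3) v

section Averages

variable {F : ℕ → ℝ → ℝ} (hF : IsJet F)
include hF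

lemma IsJet.continuous_wAvg_wZero {i : ℕ} (hi : i ≤ 5) : Continuous (wAvg wZero (F i)) :=
  continuous_wAvg continuous_wZero (hF.continuous hi)

lemma IsJet.continuous_wAvg_wOne {i : ℕ} (hi : i ≤ 5) : Continuous (wAvg wOne (F i)) :=
  continuous_wAvg continuous_wOne (hF.continuous hi)

lemma IsJet.continuous_wAvg_wTwo {i : ℕ} (hi : i ≤ 5) : Continuous (wAvg wTwo (F i)) :=
  continuous_wAvg continuous_wTwo (hF.continuous hi)

lemma IsJet.hasStrictFDerivAt_wAvg_wZero {i : ℕ} (hi : i < 4) (v : ℝ × ℝ) :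
    HasStrictFDerivAt (wAvg wZero (F i))
      ((v.1 * wAvg wOne (F (i + 2)) v) • ContinuousLinearMap.fst ℝ ℝ ℝ +
        wAvg wZero (F (i + 1)) v • ContinuousLinearMap.snd ℝ ℝ ℝ) v :=
  hasStrictFDerivAt_wAvg_even continuous_wZero hasDerivAt_wOne (by norm_num [wOne])
    (by norm_num [wOne]) (hF.hasDerivAt i (by omega)) (hF.hasDerivAt (i + 1) (by omega))
    (hF.continuous (by omega)) v

lemma IsJet.hasStrictFDerivAt_wAvg_wOne {i : ℕ} (hi : i < 4) (v : ℝ × ℝ) :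
    HasStrictFDerivAt (wAvg wOne (F i))
      ((v.1 * wAvg wTwo (F (i + 2)) v) • ContinuousLinearMap.fst ℝ ℝ ℝ +
        wAvg wOne (F (i + 1)) v • ContinuousLinearMap.snd ℝ ℝ ℝ) v :=
  hasStrictFDerivAt_wAvg_even continuous_wOne hasDerivAt_wTwo (by norm_num [wTwo])
    (by norm_num [wTwo]) (hF.hasDerivAt i (by omega)) (hF.hasDerivAt (i + 1) (by omega))
    (hF.continuous (by omega)) v

lemma IsJet.hasStrictFDerivAt_foldFn (v : ℝ × ℝ) :
    HasStrictFDerivAt (foldFn F)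
      ((v.1 * foldFnT F v) • ContinuousLinearMap.fst ℝ ℝ ℝ +
        foldFnM F v • ContinuousLinearMap.snd ℝ ℝ ℝ) v := by
  have hP := hF.hasStrictFDerivAt_wAvg_wZero (i := 1) (by norm_num) v
  have hJ := hF.hasStrictFDerivAt_wAvg_wZero (i := 2) (by norm_num) v
  have hK := hF.hasStrictFDerivAt_wAvg_wOne (i := 3) (by norm_num) v
  have ht : HasStrictFDerivAt (fun v : ℝ × ℝ => v.1) (ContinuousLinearMap.fst ℝ ℝ ℝ) v :=
    hasStrictFDerivAt_fst
  have hV := (hP.const_mul 2).add ((ht.pow 2).mul hK)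
  convert! (hK.mul hV).sub (hJ.pow 2) using 1
  ext
  · simp [foldFnT, slopeSum, trapDefect, chordSlope, chordSlopeDeriv]; ring
  · simp [foldFnM, slopeSum, trapDefect, chordSlope, chordSlopeDeriv]; ring

lemma IsJet.continuous_foldFnT : Continuous (foldFnT F) := by
  have h1 := hF.continuous_wAvg_wZero (i := 1) (by norm_num)
  have h2 := hF.continuous_wAvg_wZero (i := 2) (by norm_num)
  have h3 := hF.continuous_wAvg_wOne (i := 3) (by norm_num)
  have h4 := hF.continuous_wAvg_wOne (i := 4) (by norm_num)
  have h5 := hF.continuous_wAvg_wTwo (i := 5) (by norm_num)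
  unfold foldFnT slopeSum trapDefect chordSlope chordSlopeDeriv
  fun_prop

lemma IsJet.continuous_foldFnM : Continuous (foldFnM F) := by
  have h1 := hF.continuous_wAvg_wZero (i := 1) (by norm_num)
  have h2 := hF.continuous_wAvg_wZero (i := 2) (by norm_num)
  have h3 := hF.continuous_wAvg_wOne (i := 3) (by norm_num)
  have h4 := hF.continuous_wAvg_wOne (i := 4) (by norm_num)
  have h5 := hF.continuous_wAvg_wZero (i := 3) (by norm_num)
  unfold foldFnM slopeSum trapDefect chordSlope chordSlopeDeriv
  fun_prop

lemma IsJet.contDiff_foldFn : ContDiff ℝ 1 (foldFn F) := by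
  rw [contDiff_one_iff_fderiv]
  refine ⟨fun v => (hF.hasStrictFDerivAt_foldFn v).hasFDerivAt.differentiableAt, ?_⟩
  have : fderiv ℝ (foldFn F) = fun v => (v.1 * foldFnT F v) • ContinuousLinearMap.fst ℝ ℝ ℝ +
        foldFnM F v • ContinuousLinearMap.snd ℝ ℝ ℝ :=
    funext fun v => (hF.hasStrictFDerivAt_foldFn v).hasFDerivAt.fderiv
  rw [this]
  have h1 := hF.continuous_foldFnT
  have h2 := hF.continuous_foldFnM
  exact ((continuous_fst.mul h1).smul continuous_const).add (h2.smul continuous_const)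

/-- Where `∂E/∂m ≠ 0`, the zero set of `E` is a graph `m = M(t)`, and `M'(t)/t` is continuous. -/
lemma IsJet.exists_foldCurve {y₀ : ℝ} (h0 : foldFn F (0, y₀) = 0) (hm : foldFnM F (0, y₀) ≠ 0) :
    ∃ M ν : ℝ → ℝ, M 0 = y₀ ∧ ν 0 = -foldFnT F (0, y₀) / foldFnM F (0, y₀) ∧
      (∀ᶠ t in 𝓝 0, HasDerivAt M (t * ν t) t ∧ ContinuousAt ν t ∧ foldFn F (t, M t) = 0) ∧
      ∀ᶠ v in 𝓝 ((0 : ℝ), y₀), foldFn F v = 0 → M v.1 = v.2 := by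
  have cdf : ContDiffAt ℝ 1 (foldFn F) (0, y₀) := hF.contDiff_foldFn.contDiffAt
  have if₂ : (fderiv ℝ (foldFn F) (0, y₀) ∘L .inr ℝ ℝ ℝ).IsInvertible := by
    refine ⟨ContinuousLinearEquiv.unitsEquivAut ℝ (Units.mk0 _ hm), ?_⟩
    rw [(hF.hasStrictFDerivAt_foldFn _).hasFDerivAt.fderiv]
    ext
    simp
  set M := cdf.implicitFunction one_ne_zero if₂ with hM
  have hM0 : M 0 = y₀ := cdf.implicitFunction_apply_self one_ne_zero if₂
  have hMc : ContDiffAt ℝ 1 M 0 := cdf.contDiffAt_implicitFunction one_ne_zero if₂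
  have hz : ∀ᶠ t in 𝓝 (0 : ℝ), foldFn F (t, M t) = 0 := by
    have := cdf.eventually_apply_implicitFunction one_ne_zero if₂
    simpa [h0] using this
  set ν : ℝ → ℝ := fun t => -foldFnT F (t, M t) / foldFnM F (t, M t) with hν
  have hMev : ∀ᶠ t in 𝓝 (0 : ℝ), ContDiffAt ℝ 1 M t := hMc.eventually (by simp)
  have hmev : ∀ᶠ t in 𝓝 (0 : ℝ), foldFnM F (t, M t) ≠ 0 := by
    have : ContinuousAt (fun t => foldFnM F (t, M t)) 0 :=
      hF.continuous_foldFnM.continuousAt.comp (continuousAt_id.prodMk hMc.continuousAt)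
    refine this.eventually_ne ?_
    simpa [hM0] using hm
  refine ⟨M, ν, hM0, by simp [hν, hM0], ?_, ?_⟩
  · filter_upwards [hMev, hmev, hz, hz.eventually_nhds] with t h1 h2 h3 h4
    have hd : HasDerivAt M (deriv M t) t := (h1.differentiableAt (by simp)).hasDerivAt
    have hcomp := (hF.hasStrictFDerivAt_foldFn (t, M t)).hasFDerivAt.comp_hasDerivAt t
      ((hasDerivAt_id t).prodMk hd)
    have hzero : HasDerivAt (foldFn F ∘ fun t => (id t, M t)) 0 t :=
      (hasDerivAt_const t (0 : ℝ)).congr_of_eventuallyEq h4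
    have heq := hcomp.unique hzero
    simp only [add_apply, smul_apply,
      ContinuousLinearMap.coe_fst', ContinuousLinearMap.coe_snd', smul_eq_mul, mul_one] at heq
    refine ⟨?_, ?_, h3⟩
    · convert! hd using 1
      simp only [hν]
      field_simp
      linarith
    · have hc : ContinuousAt (fun t => (t, M t)) t := continuousAt_id.prodMk h1.continuousAt
      exact ((hF.continuous_foldFnT.continuousAt.comp hc).neg).div
        (hF.continuous_foldFnM.continuousAt.comp hc) h2
  · filter_upwards [cdf.eventually_apply_eq_iff_implicitFunction one_ne_zero if₂] with v hv h
    exact hv.1 (by rw [h, h0])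

end Averages

section Averages

variable {F : ℕ → ℝ → ℝ} (hF : IsJet F)
include hF

lemma IsJet.hasDerivAt_wAvg_wZero_curve {i : ℕ} (hi : i < 4) {M : ℝ → ℝ} {t n : ℝ}
    (hM : HasDerivAt M (t * n) t) :
    HasDerivAt (fun t => wAvg wZero (F i) (t, M t))
      (t * (wAvg wOne (F (i + 2)) (t, M t) + wAvg wZero (F (i + 1)) (t, M t) * n)) t := by
  convert! (hF.hasStrictFDerivAt_wAvg_wZero hi (t, M t)).hasFDerivAt.comp_hasDerivAt t
    ((hasDerivAt_id t).prodMk hM) using 1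
  simp; ring

lemma IsJet.hasDerivAt_wAvg_wOne_curve {i : ℕ} (hi : i < 4) {M : ℝ → ℝ} {t n : ℝ}
    (hM : HasDerivAt M (t * n) t) :
    HasDerivAt (fun t => wAvg wOne (F i) (t, M t))
      (t * (wAvg wTwo (F (i + 2)) (t, M t) + wAvg wOne (F (i + 1)) (t, M t) * n)) t := by
  convert! (hF.hasStrictFDerivAt_wAvg_wOne hi (t, M t)).hasFDerivAt.comp_hasDerivAt t
    ((hasDerivAt_id t).prodMk hM) using 1
  simp; ring

end Averages

/-- The coordinate `q - y₀ p` of the parameter `(p, q)` whose 2-cycle is `{m + t, m - t}`. -/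
noncomputable def cycleOffset (F : ℕ → ℝ → ℝ) (y₀ : ℝ) (v : ℝ × ℝ) : ℝ :=
  (F 0 (v.2 + v.1) + F 0 (v.2 - v.1)) / 2 + chordSlope F v * (v.2 - y₀)

/-- The coordinate `q - y₀ p` of the flip parameter `L₀(y)`. -/
noncomputable def flipOffset (F : ℕ → ℝ → ℝ) (y₀ y : ℝ) : ℝ := F 1 y * (y - y₀) + F 0 y

section Averages

variable {F : ℕ → ℝ → ℝ} (hF : IsJet F)
include hF

lemma IsJet.hasDerivAt_flipOffset (y₀ y : ℝ) :
    HasDerivAt (flipOffset F y₀) (2 * F 1 y + (y - y₀) * F 2 y) y := by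
  convert! ((hF.hasDerivAt 1 (by norm_num) y).mul ((hasDerivAt_id y).sub_const y₀)).add
    (hF.hasDerivAt 0 (by norm_num) y) using 1
  simp; ring

lemma IsJet.contDiffAt_flipOffset (y₀ y : ℝ) : ContDiffAt ℝ 1 (flipOffset F y₀) y := by
  refine contDiffAt_one_of_hasDerivAt (f' := fun y => 2 * F 1 y + (y - y₀) * F 2 y)
    (Eventually.of_forall fun x => ⟨hF.hasDerivAt_flipOffset y₀ x, ?_⟩)
  have h1 := hF.continuous (i := 1) (by norm_num)
  have h2 := hF.continuous (i := 2) (by norm_num)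
  fun_prop

lemma IsJet.hasDerivAt_cycleOffset_curve (y₀ : ℝ) {M : ℝ → ℝ} {t n : ℝ}
    (hM : HasDerivAt M (t * n) t) :
    HasDerivAt (fun t => cycleOffset F y₀ (t, M t))
      (t * (slopeSum F (t, M t) * n + chordSlopeDeriv F (t, M t) + (M t - y₀) *
        (trapDefect F (t, M t) + chordSlopeDeriv F (t, M t) * n))) t := by
  have h1 : HasDerivAt (fun t => F 0 (M t + t)) (F 1 (M t + t) * (t * n + 1)) t :=
    (hF.hasDerivAt 0 (by norm_num) (M t + t)).comp (h := fun t => M t + t) t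
      (hM.add (hasDerivAt_id t))
  have h2 : HasDerivAt (fun t => F 0 (M t - t)) (F 1 (M t - t) * (t * n - 1)) t :=
    (hF.hasDerivAt 0 (by norm_num) (M t - t)).comp (h := fun t => M t - t) t
      (hM.sub (hasDerivAt_id t))
  have h3 := hF.hasDerivAt_wAvg_wZero_curve (i := 1) (by norm_num) hM
  have e1 := add_eq_wAvg (hF.hasDerivAt 1 (by norm_num)) (hF.hasDerivAt 2 (by norm_num))
    (hF.continuous (by norm_num)) t (M t)
  have e2 := wAvg_wZero_eq (hF.hasDerivAt 1 (by norm_num)) (hF.continuous (i := 2) (by norm_num))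
    t (M t)
  convert! ((h1.add h2).div_const 2).add (h3.mul (hM.sub_const y₀)) using 1
  simp only [slopeSum, chordSlope, chordSlopeDeriv, trapDefect] at *
  norm_num at e1 e2 ⊢
  have a1 : F 1 (M t + t) = wAvg wZero (F 1) (t, M t) + t ^ 2 * wAvg wOne (F 3) (t, M t) +
      t * wAvg wZero (F 2) (t, M t) := by linarith
  have a2 : F 1 (M t - t) = wAvg wZero (F 1) (t, M t) + t ^ 2 * wAvg wOne (F 3) (t, M t) -
      t * wAvg wZero (F 2) (t, M t) := by linarith
  rw [a1, a2]
  ring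

end Averages

/-- The leading term at `0` of a function, read off from that of its derivative. -/
lemma tendsto_div_pow_of_hasDerivAt {u g : ℝ → ℝ} {c : ℝ} (n : ℕ)
    (hu : ∀ᶠ t in 𝓝[>] (0 : ℝ), HasDerivAt u (t ^ n * g t) t) (hu0 : Tendsto u (𝓝[>] 0) (𝓝 0))
    (hg : Tendsto g (𝓝[>] 0) (𝓝 c)) :
    Tendsto (fun t => u t / t ^ (n + 1)) (𝓝[>] 0) (𝓝 (c / (n + 1))) := by
  refine HasDerivAt.lhopital_zero_nhdsGT (f' := fun t => t ^ n * g t)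
    (g' := fun t => (n + 1) * t ^ n) hu (Eventually.of_forall fun t => ?_) ?_ hu0 ?_ ?_
  · simpa using hasDerivAt_pow (n + 1) t
  · filter_upwards [self_mem_nhdsWithin] with t ht
    have : (0 : ℝ) < t := ht
    positivity
  · have : Tendsto (fun t : ℝ => t ^ (n + 1)) (𝓝 0) (𝓝 (0 ^ (n + 1))) :=
      (continuous_pow (n + 1)).tendsto 0
    rw [zero_pow (by omega)] at this
    exact this.mono_left nhdsWithin_le_nhds
  · refine (hg.div_const ((n : ℝ) + 1)).congr' ?_
    filter_upwards [self_mem_nhdsWithin] with t ht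
    have : (0 : ℝ) < t := ht
    have h2 : (n : ℝ) + 1 ≠ 0 := by positivity
    field_simp

/-- Near a flip at which the Schwarzian derivative has a simple zero and which satisfies the
nondegeneracy condition `hC`, the degenerate 2-cycles `{m + t, m - t}` are given by `m = M(t)`.
In the coordinates `R = q - y₀ p` and `λ = p - F'(Y(R))`, in which `L₀` is the line `λ = 0`, the
image of this curve is `R = b(t²)`, `α λ = -c(t²)²/4` with `b` and `c` invertible `C¹` functions. -/
theorem IsJet.exists_foldCurve_normalForm {F : ℕ → ℝ → ℝ} (hF : IsJet F) {y₀ : ℝ}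
    (hp : 0 < F 1 y₀) (hN : 2 * F 1 y₀ * F 3 y₀ - 3 * F 2 y₀ ^ 2 = 0)
    (hN' : 2 * F 1 y₀ * F 4 y₀ - 4 * F 2 y₀ * F 3 y₀ ≠ 0)
    (hC : 2 * F 1 y₀ ^ 3 * F 5 y₀ - 15 * F 1 y₀ ^ 2 * F 2 y₀ * F 4 y₀ + 30 * F 2 y₀ ^ 4 ≠ 0) :
    ∃ (e : OpenPartialHomeomorph ℝ ℝ) (M b c : ℝ → ℝ) (α b' c' : ℝ),
      y₀ ∈ e.source ∧ ⇑e = flipOffset F y₀ ∧ ContDiffOn ℝ 1 e.symm e.target ∧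
      M 0 = y₀ ∧ ContinuousAt M 0 ∧
      (∀ᶠ t in 𝓝 0, foldFn F (t, M t) = 0) ∧
      (∀ᶠ v in 𝓝 ((0 : ℝ), y₀), foldFn F v = 0 → M v.1 = v.2) ∧
      α ^ 2 = 1 ∧ ContDiffAt ℝ 1 b 0 ∧ HasDerivAt b b' 0 ∧ b' ≠ 0 ∧
      ContDiffAt ℝ 1 c 0 ∧ HasDerivAt c c' 0 ∧ 0 < c' ∧ c 0 = 0 ∧
      ∀ᶠ t in 𝓝[≥] 0, b (t ^ 2) = cycleOffset F y₀ (t, M t) ∧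
        α * (chordSlope F (t, M t) - F 1 (e.symm (cycleOffset F y₀ (t, M t)))) =
          -(c (t ^ 2)) ^ 2 / 4 := by
  have z0 : ∀ i, wAvg wZero (F i) (0, y₀) = F i y₀ := fun i => by
    rw [wAvg_zero, integral_wZero, one_mul]
  have z1 : ∀ i, wAvg wOne (F i) (0, y₀) = F i y₀ / 3 := fun i => by
    rw [wAvg_zero, integral_wOne]; ring
  have z2 : ∀ i, wAvg wTwo (F i) (0, y₀) = F i y₀ / 15 := fun i => by
    rw [wAvg_zero, integral_wTwo]; ring
  have hF3 : F 3 y₀ = 3 * F 2 y₀ ^ 2 / (2 * F 1 y₀) := by field_simp; linarith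
  have hE0 : foldFn F (0, y₀) = 0 := by
    simp only [foldFn, slopeSum, trapDefect, chordSlope, chordSlopeDeriv, z0, z1]
    linarith
  have hEm : foldFnM F (0, y₀) = (2 * F 1 y₀ * F 4 y₀ - 4 * F 2 y₀ * F 3 y₀) / 3 := by
    simp only [foldFnM, slopeSum, trapDefect, chordSlope, chordSlopeDeriv, z0, z1]
    ring
  have hEt : foldFnT F (0, y₀) = 2 * F 1 y₀ * F 5 y₀ / 15 + 4 * F 3 y₀ ^ 2 / 9 -
      2 * F 2 y₀ * F 4 y₀ / 3 := by
    simp only [foldFnT, slopeSum, trapDefect, chordSlope, chordSlopeDeriv, z0, z1, z2]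
    ring
  have hEm0 : foldFnM F (0, y₀) ≠ 0 := by
    rw [hEm]; exact div_ne_zero hN' (by norm_num)
  obtain ⟨M, ν, hM0, hν0, hMν, hMu⟩ := hF.exists_foldCurve hE0 hEm0
  obtain ⟨e, hes, he, -, hesymm⟩ := exists_openPartialHomeomorph_real
    (hF.contDiffAt_flipOffset y₀ y₀) (hF.hasDerivAt_flipOffset y₀ y₀) (by simpa using hp.ne')
  have hMc : ContinuousAt M 0 := hMν.self_of_nhds.1.continuousAt
  set P : ℝ → ℝ := fun t => chordSlope F (t, M t) with hPdef
  set J : ℝ → ℝ := fun t => chordSlopeDeriv F (t, M t) with hJdef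
  set K : ℝ → ℝ := fun t => trapDefect F (t, M t) with hKdef
  set V : ℝ → ℝ := fun t => slopeSum F (t, M t) with hVdef
  set R : ℝ → ℝ := fun t => cycleOffset F y₀ (t, M t) with hRdef
  set Y : ℝ → ℝ := fun t => e.symm (R t) with hYdef
  set S : ℝ → ℝ := fun t => wAvg wOne (F 4) (t, M t) with hSdef
  set T : ℝ → ℝ := fun t => wAvg wTwo (F 5) (t, M t) with hTdef
  set J₁ : ℝ → ℝ := fun t => wAvg wZero (F 3) (t, M t) with hJ₁def
  set μ : ℝ → ℝ := fun t => ν t + J t / V t with hμdef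
  set den : ℝ → ℝ := fun t => 2 * F 1 (Y t) + (Y t - y₀) * F 2 (Y t) with hdendef
  have hP0 : P 0 = F 1 y₀ := by simp only [hPdef, chordSlope, hM0, z0]
  have hJ0 : J 0 = F 2 y₀ := by simp only [hJdef, chordSlopeDeriv, hM0, z0]
  have hK0 : K 0 = F 3 y₀ / 3 := by simp only [hKdef, trapDefect, hM0, z1]
  have hV0 : V 0 = 2 * F 1 y₀ := by
    simp only [hVdef, slopeSum, chordSlope, trapDefect, hM0, z0, z1]; ring
  have hS0 : S 0 = F 4 y₀ / 3 := by simp only [hSdef, hM0, z1]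
  have hJ₁0 : J₁ 0 = F 3 y₀ := by simp only [hJ₁def, hM0, z0]
  have hR0 : R 0 = F 0 y₀ := by simp only [hRdef, cycleOffset, hM0]; simp
  have heF : e y₀ = F 0 y₀ := by rw [he]; simp [flipOffset]
  have hY0 : Y 0 = y₀ := by simp only [hYdef]; rw [hR0, ← heF, e.left_inv hes]
  have hden0 : den 0 = 2 * F 1 y₀ := by simp [hdendef, hY0]
  -- `μ` measures how fast `R` moves with `t²`; the nondegeneracy condition `hC` says `μ 0 ≠ 0`
  have hμ0 : μ 0 ≠ 0 := by
    simp only [hμdef, hν0, hJ0, hV0, hEm]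
    intro h
    have h1 : F 2 y₀ * (2 * F 1 y₀ * F 4 y₀ - 4 * F 2 y₀ * F 3 y₀) =
        6 * F 1 y₀ * foldFnT F (0, y₀) := by
      generalize 2 * F 1 y₀ * F 4 y₀ - 4 * F 2 y₀ * F 3 y₀ = x at h hN'
      field_simp at h
      linarith
    apply hC
    rw [hEt, hF3] at h1
    field_simp at h1
    linear_combination (-1 / 648) * h1
  have hcurve : ∀ᶠ t in 𝓝 (0 : ℝ), HasDerivAt M (t * ν t) t ∧ ContinuousAt ν t ∧
      foldFn F (t, M t) = 0 := hMν
  have hcc : ∀ {G : ℝ × ℝ → ℝ} {t : ℝ}, Continuous G → ContinuousAt M t →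
      ContinuousAt (fun t => G (t, M t)) t := fun hG hM =>
    hG.continuousAt.comp (continuousAt_id.prodMk hM)
  have c01 := hF.continuous_wAvg_wZero (i := 1) (by norm_num)
  have c02 := hF.continuous_wAvg_wZero (i := 2) (by norm_num)
  have c03 := hF.continuous_wAvg_wZero (i := 3) (by norm_num)
  have c13 := hF.continuous_wAvg_wOne (i := 3) (by norm_num)
  have c14 := hF.continuous_wAvg_wOne (i := 4) (by norm_num)
  have c25 := hF.continuous_wAvg_wTwo (i := 5) (by norm_num)
  have cV : Continuous (slopeSum F) := by
    unfold slopeSum chordSlope trapDefect; fun_prop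
  have hVev : ∀ᶠ t in 𝓝 (0 : ℝ), V t ≠ 0 :=
    (hcc cV hMc).eventually_ne (by change V 0 ≠ 0; rw [hV0]; positivity)
  have hKV : ∀ᶠ t in 𝓝 (0 : ℝ), K t = J t ^ 2 / V t := by
    filter_upwards [hcurve, hVev] with t ht hV
    have := ht.2.2
    simp only [foldFn] at this
    rw [eq_div_iff hV]
    exact sub_eq_zero.1 this
  -- because `K V = J²` on the curve, the derivatives of `P` and `R` share the factor `μ`
  have hPd : ∀ᶠ t in 𝓝 (0 : ℝ), HasDerivAt P (t * (J t * μ t)) t := by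
    filter_upwards [hcurve, hKV] with t ht hK
    convert! hF.hasDerivAt_wAvg_wZero_curve (i := 1) (by norm_num) ht.1 using 1
    change _ = t * (K t + J t * ν t)
    rw [hK]; simp only [hμdef]; ring
  have hRd : ∀ᶠ t in 𝓝 (0 : ℝ),
      HasDerivAt R (t * ((V t + (M t - y₀) * J t) * μ t)) t := by
    filter_upwards [hcurve, hKV, hVev] with t ht hK hV
    convert! hF.hasDerivAt_cycleOffset_curve y₀ ht.1 using 1
    change _ = t * (V t * ν t + J t + (M t - y₀) * (K t + J t * ν t))
    rw [hK]; simp only [hμdef]; field_simp; ring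
  have hμc : ∀ᶠ t in 𝓝 (0 : ℝ), ContinuousAt μ t := by
    filter_upwards [hcurve, hVev] with t ht hV
    exact ht.2.1.add ((hcc c02 ht.1.continuousAt).div (hcc cV ht.1.continuousAt) hV)
  have hRc : ContinuousAt R 0 := hRd.self_of_nhds.continuousAt
  have hRt : ∀ᶠ t in 𝓝 (0 : ℝ), R t ∈ e.target :=
    hRc.eventually (e.open_target.mem_nhds (by rw [hR0, ← heF]; exact e.map_source hes))
  have hYc : ContinuousAt Y 0 := ContinuousAt.comp (g := e.symm)
    (e.continuousAt_symm hRt.self_of_nhds) hRc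
  have hFc1 := hF.continuous (i := 1) (by norm_num)
  have hFc2 := hF.continuous (i := 2) (by norm_num)
  have hFc3 := hF.continuous (i := 3) (by norm_num)
  have hdenev : ∀ᶠ t in 𝓝 (0 : ℝ), den t ≠ 0 := by
    have : ContinuousAt den 0 :=
      ContinuousAt.comp (g := fun y => 2 * F 1 y + (y - y₀) * F 2 y)
        (by fun_prop) hYc
    exact this.eventually_ne (by rw [hden0]; positivity)
  have hYd : ∀ᶠ t in 𝓝 (0 : ℝ),
      HasDerivAt Y (t * ((V t + (M t - y₀) * J t) * μ t / den t)) t := by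
    filter_upwards [hRd, hRt, hdenev] with t h1 h2 h3
    have h4 : HasDerivAt e (den t) (e.symm (R t)) := by
      rw [he]; exact hF.hasDerivAt_flipOffset y₀ _
    convert! (e.hasDerivAt_symm h2 h3 h4).comp t h1 using 1
    field_simp
  set lam : ℝ → ℝ := fun t => P t - F 1 (Y t) with hlamdef
  set ψ : ℝ → ℝ := fun t => J t - F 2 (Y t) / den t * (V t + (M t - y₀) * J t) with hψdef
  have hlamd : ∀ᶠ t in 𝓝 (0 : ℝ), HasDerivAt lam (t * (μ t * ψ t)) t := by
    filter_upwards [hPd, hYd] with t h1 h2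
    convert! h1.sub ((hF.hasDerivAt 1 (by norm_num) (Y t)).comp t h2) using 1
    simp only [hψdef]; ring
  -- `ψ` vanishes at `0`, and the coefficient of `t²` in it is a multiple of the derivative of the
  -- Schwarzian numerator
  obtain ⟨χ, hχd, hχc, hχ0⟩ : ∃ χ : ℝ → ℝ, (∀ᶠ t in 𝓝 (0 : ℝ), HasDerivAt ψ (t * χ t) t) ∧
      ContinuousAt χ 0 ∧
      χ 0 = (2 * F 1 y₀ * F 4 y₀ - 4 * F 2 y₀ * F 3 y₀) / (6 * F 1 y₀) := by
    set y' : ℝ → ℝ := fun t => (V t + (M t - y₀) * J t) * μ t / den t with hy'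
    set J' : ℝ → ℝ := fun t => S t + J₁ t * ν t with hJ'
    set V' : ℝ → ℝ := fun t => 2 * (J t * μ t) + (2 * K t + t ^ 2 * (T t + S t * ν t)) with hV'
    refine ⟨fun t => J' t - ((F 3 (Y t) * den t - F 2 (Y t) *
      (3 * F 2 (Y t) + (Y t - y₀) * F 3 (Y t))) / den t ^ 2 * y' t * (V t + (M t - y₀) * J t) +
      F 2 (Y t) / den t * (V' t + (ν t * J t + (M t - y₀) * J' t))), ?_, ?_, ?_⟩
    · filter_upwards [hcurve, hPd, hYd, hdenev] with t ht hP hY hden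
      have dM := ht.1
      have dJ : HasDerivAt J (t * J' t) t :=
        hF.hasDerivAt_wAvg_wZero_curve (i := 2) (by norm_num) ht.1
      have dK : HasDerivAt K (t * (T t + S t * ν t)) t :=
        hF.hasDerivAt_wAvg_wOne_curve (i := 3) (by norm_num) ht.1
      have dV : HasDerivAt V (t * V' t) t := by
        convert! (hP.const_mul 2).add (((hasDerivAt_id t).pow 2).mul dK) using 1
        simp [hV']; ring
      have d2 : HasDerivAt (fun t => F 2 (Y t)) (F 3 (Y t) * (t * y' t)) t :=
        (hF.hasDerivAt 2 (by norm_num) (Y t)).comp t hY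
      have d1 : HasDerivAt (fun t => F 1 (Y t)) (F 2 (Y t) * (t * y' t)) t :=
        (hF.hasDerivAt 1 (by norm_num) (Y t)).comp t hY
      have dden : HasDerivAt den (t * (y' t *
          (3 * F 2 (Y t) + (Y t - y₀) * F 3 (Y t)))) t := by
        convert! (d1.const_mul 2).add ((hY.sub_const y₀).mul d2) using 1
        ring
      convert! dJ.sub ((d2.div dden hden).mul (dV.add ((dM.sub_const y₀).mul dJ))) using 1
      simp only [Pi.div_apply, Pi.add_apply, Pi.mul_apply]
      field_simp
    · have a1 : ContinuousAt P 0 := hcc c01 hMc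
      have a2 : ContinuousAt J 0 := hcc c02 hMc
      have a3 : ContinuousAt K 0 := hcc c13 hMc
      have a4 : ContinuousAt V 0 := hcc cV hMc
      have a5 : ContinuousAt S 0 := hcc c14 hMc
      have a6 : ContinuousAt T 0 := hcc c25 hMc
      have a7 : ContinuousAt J₁ 0 := hcc c03 hMc
      have a8 : ContinuousAt ν 0 := hcurve.self_of_nhds.2.1
      have a9 : ContinuousAt μ 0 := hμc.self_of_nhds
      have b2 : ContinuousAt (fun t => F 2 (Y t)) 0 := ContinuousAt.comp (g := F 2)
        hFc2.continuousAt hYc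
      have b3 : ContinuousAt (fun t => F 3 (Y t)) 0 := ContinuousAt.comp (g := F 3)
        hFc3.continuousAt hYc
      have b1 : ContinuousAt (fun t => F 1 (Y t)) 0 := ContinuousAt.comp (g := F 1)
        hFc1.continuousAt hYc
      have b4 : ContinuousAt den 0 := by simp only [hdendef]; fun_prop
      have b5 : den 0 ≠ 0 := hdenev.self_of_nhds
      have b6 : ContinuousAt y' 0 := by simp only [hy']; fun_prop (disch := assumption)
      have b7 : ContinuousAt J' 0 := by simp only [hJ']; fun_prop
      have b8 : ContinuousAt V' 0 := by simp only [hV']; fun_prop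
      have b9 : den 0 ^ 2 ≠ 0 := pow_ne_zero 2 b5
      fun_prop (disch := assumption)
    · simp only [hy', hJ', hV', hY0, hM0, hden0, hV0, hJ0, hK0, hS0, hJ₁0, hμdef, sub_self,
        zero_mul, add_zero, hF3]
      field_simp
      ring
  have hχne : χ 0 ≠ 0 := by
    rw [hχ0]; exact div_ne_zero hN' (by positivity)
  have hle : 𝓝[>] (0 : ℝ) ≤ 𝓝 0 := nhdsWithin_le_nhds
  have hψ0 : ψ 0 = 0 := by
    simp only [hψdef, hJ0, hY0, hden0, hV0, hM0]
    field_simp; ring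
  have hlam0 : lam 0 = 0 := by simp only [hlamdef, hP0, hY0]; ring
  have hψc : ContinuousAt ψ 0 := hχd.self_of_nhds.continuousAt
  have hlamc : ContinuousAt lam 0 := hlamd.self_of_nhds.continuousAt
  have hψlim : Tendsto (fun t => ψ t / t ^ 2) (𝓝[>] 0) (𝓝 (χ 0 / 2)) := by
    have := tendsto_div_pow_of_hasDerivAt 1 (u := ψ) (g := χ) (c := χ 0)
      ((hχd.filter_mono hle).mono fun t ht => by simpa using ht)
      (by have := hψc.tendsto; rw [hψ0] at this; exact this.mono_left hle)
      (hχc.tendsto.mono_left hle)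
    norm_num at this
    exact this
  have hμt : Tendsto μ (𝓝[>] 0) (𝓝 (μ 0)) := hμc.self_of_nhds.tendsto.mono_left hle
  set κ : ℝ := μ 0 * (χ 0 / 2) / 4 with hκ
  have hκ0 : κ ≠ 0 := by positivity
  have hlamlim : Tendsto (fun t => lam t / t ^ 4) (𝓝[>] 0) (𝓝 κ) := by
    have := tendsto_div_pow_of_hasDerivAt 3 (u := lam) (g := fun t => μ t * (ψ t / t ^ 2))
      (c := μ 0 * (χ 0 / 2)) (by
        filter_upwards [hle hlamd, self_mem_nhdsWithin] with t ht h0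
        have h0 : 0 < t := h0
        convert! ht using 1
        field_simp)
      (by have := hlamc.tendsto; rw [hlam0] at this; exact this.mono_left hle)
      (hμt.mul hψlim)
    norm_num at this
    convert! this using 2
  -- `α` makes `-α λ ~ -α κ t⁴` positive, so that `c(t²) = 2 √(-α λ)` is `C¹` in `t²`
  obtain ⟨α, hα, hακ⟩ : ∃ α : ℝ, α ^ 2 = 1 ∧ 0 < -α * κ := by
    rcases lt_or_gt_of_ne hκ0 with h | h
    · exact ⟨1, by norm_num, by linarith⟩
    · exact ⟨-1, by norm_num, by linarith⟩
  have hlim2 : Tendsto (fun t => -α * (lam t / t ^ 4)) (𝓝[>] 0) (𝓝 (-α * κ)) :=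
    hlamlim.const_mul _
  have hpos : ∀ᶠ t in 𝓝[>] (0 : ℝ), 0 < -α * lam t := by
    filter_upwards [hlim2.eventually (eventually_gt_nhds hακ), self_mem_nhdsWithin] with t ht h0
    have h0 : 0 < t := h0
    have : -α * lam t = -α * (lam t / t ^ 4) * t ^ 4 := by field_simp
    rw [this]; positivity
  obtain ⟨b, hb1, hb2, hb3⟩ := exists_contDiffAt_comp_sq (a := R) (a₀ := R 0)
    (g := fun t => (V t + (M t - y₀) * J t) * μ t / 2)
    (g₀ := (V 0 + (M 0 - y₀) * J 0) * μ 0 / 2) (by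
      filter_upwards [hle hRd, hle hμc, hle hcurve] with t h1 h2 h3
      refine ⟨by convert! h1 using 1; ring, ?_⟩
      have k1 : ContinuousAt V t := hcc cV h3.1.continuousAt
      have k2 : ContinuousAt J t := hcc c02 h3.1.continuousAt
      have k3 := h3.1.continuousAt
      fun_prop) (hRc.tendsto.mono_left hle) (by
      have k1 : ContinuousAt V 0 := hcc cV hMc
      have k2 : ContinuousAt J 0 := hcc c02 hMc
      have k3 := hμc.self_of_nhds
      have : ContinuousAt (fun t => (V t + (M t - y₀) * J t) * μ t / 2) 0 := by fun_prop
      exact this.tendsto.mono_left hle) rfl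
  obtain ⟨c, hc1, hc2, hc3⟩ := exists_contDiffAt_comp_sq (a := fun t => 2 * √(-α * lam t))
    (a₀ := 0) (g := fun t => -α * (μ t * ψ t) / (2 * √(-α * lam t)))
    (g₀ := -α * (μ 0 * (χ 0 / 2)) / (2 * √(-α * κ))) (by
      filter_upwards [hle hlamd, hle hμc, hle hχd, hpos] with t h1 h2 h3 h4
      have hs : 0 < √(-α * lam t) := Real.sqrt_pos.2 h4
      refine ⟨?_, ?_⟩
      · convert! ((h1.const_mul (-α)).sqrt h4.ne').const_mul 2 using 1
        field_simp
      · have k1 := h1.continuousAt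
        have k3 := h3.continuousAt
        have k4 : 2 * √(-α * lam t) ≠ 0 := by positivity
        fun_prop (disch := assumption))
    (by
      have : ContinuousAt (fun t => 2 * √(-α * lam t)) 0 := by fun_prop
      have := this.tendsto
      simp only [hlam0, mul_zero, Real.sqrt_zero] at this
      exact this.mono_left hle)
    (by
      have hsq : Tendsto (fun t => 2 * √(-α * (lam t / t ^ 4))) (𝓝[>] 0)
          (𝓝 (2 * √(-α * κ))) := (hlim2.sqrt).const_mul 2
      have hnum : Tendsto (fun t => -α * (μ t * (ψ t / t ^ 2))) (𝓝[>] 0)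
          (𝓝 (-α * (μ 0 * (χ 0 / 2)))) := (hμt.mul hψlim).const_mul _
      refine (hnum.div hsq (by positivity)).congr' ?_
      filter_upwards [self_mem_nhdsWithin, hpos] with t h0 hl
      have h0 : 0 < t := h0
      have hs : 0 < √(-α * lam t) := Real.sqrt_pos.2 hl
      have : √(-α * (lam t / t ^ 4)) = √(-α * lam t) / t ^ 2 := by
        rw [← mul_div_assoc, Real.sqrt_div hl.le, show t ^ 4 = (t ^ 2) ^ 2 by ring,
          Real.sqrt_sq (by positivity)]
      simp only [Pi.div_apply, this]
      field_simp) (by simp [hlam0])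
  refine ⟨e, M, b, c, α, _, _, hes, he, hesymm, hM0, hMc, hcurve.mono fun t h => h.2.2, hMu, hα,
    hb1, hb2, ?_, hc1, hc2, ?_, ?_, ?_⟩
  · simp only [hM0, hV0, sub_self, zero_mul, add_zero]
    have := hp.ne'
    positivity
  · have : -α * (μ 0 * (χ 0 / 2)) = 4 * (-α * κ) := by simp only [hκ]; ring
    rw [this]
    have := Real.sqrt_pos.2 hακ
    positivity
  · have := hc3 0 le_rfl
    simpa [hlam0] using this
  · have hge : ∀ᶠ t in 𝓝[≥] (0 : ℝ), 0 ≤ -α * lam t := by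
      rw [← Ioi_insert, nhdsWithin_insert, eventually_sup]
      exact ⟨by simp [hlam0], hpos.mono fun t h => h.le⟩
    filter_upwards [hge, self_mem_nhdsWithin] with t h1 h2
    refine ⟨hb3 t h2, ?_⟩
    rw [hc3 t h2]
    change α * lam t = _
    rw [mul_pow, Real.sq_sqrt h1]; ring

/-! ### The horizon, the model and the flip condition -/

/-- The points of the horizon over `(p, q)` are the degenerate 2-cycles `{y, z}` (possibly `y = z`)
of the decreasing map `x ↦ (q - f(x)) / p`. -/
lemma mem_apparentContour_phiZero {f f' : ℝ → ℝ} (hf : ∀ y ∈ Ioo (-1 : ℝ) 1, HasDerivAt f (f' y) y)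
    (U : Set ℝ) (x : ℝ × ℝ) :
    x ∈ apparentContour (phiZeroDomain f) (phiZero f) U ↔
      ∃ y ∈ U, ∃ z, 0 < x.1 ∧ y ∈ Ioo (-1 : ℝ) 1 ∧ z ∈ Ioo (-1 : ℝ) 1 ∧ f y + x.1 * z = x.2 ∧
        f z + x.1 * y = x.2 ∧ f' y * f' z = x.1 ^ 2 := by
  obtain ⟨p, q⟩ := x
  simp only [apparentContour, horizon, phiZeroDomain, mem_ofPred_eq]
  have key : ∀ y z, 0 < p → y ∈ Ioo (-1 : ℝ) 1 → z ∈ Ioo (-1 : ℝ) 1 →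
      -(1 / p) * f y + q / p = z →
      deriv (fun y => phiZero f y p q) y = -p + f' z * f' y / p := by
    intro y z hp hy hz h
    have h1 : HasDerivAt (fun y => -(1 / p) * f y + q / p) (-(1 / p) * f' y) y :=
      ((hf y hy).const_mul _).add_const _
    have h2 : HasDerivAt (fun y => f (-(1 / p) * f y + q / p)) (f' z * (-(1 / p) * f' y)) y := by
      refine HasDerivAt.comp (h₂ := f) y ?_ h1
      rw [h]; exact hf z hz
    have h3 : HasDerivAt (fun y => phiZero f y p q) (-p - f' z * (-(1 / p) * f' y)) y := by
      unfold phiZero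
      have := ((hasDerivAt_id y).const_mul (-p)).add_const q
      simp only [mul_one] at this
      exact this.sub h2
    rw [h3.deriv]; ring
  constructor
  · rintro ⟨y, hyU, ⟨hp, hy, hz⟩, h1, h2⟩
    refine ⟨y, hyU, -(1 / p) * f y + q / p, hp, hy, hz, ?_, ?_, ?_⟩
    · field_simp; ring
    · simp only [phiZero] at h1; linarith
    · rw [key y _ hp hy hz rfl] at h2
      field_simp at h2
      field_simp
      linarith
  · rintro ⟨y, hyU, z, hp, hy, hz, h1, h2, h3⟩
    have e : -(1 / p) * f y + q / p = z := by field_simp; linarith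
    refine ⟨y, hyU, ⟨hp, hy, by rw [e]; exact hz⟩, ?_, ?_⟩
    · simp only [phiZero, e]; linarith
    · rw [key y z hp hy hz e]; field_simp; linarith

lemma mem_apparentContour_flipModel (x : ℝ × ℝ) :
    x ∈ apparentContour univ flipModel univ ↔ x.1 = 0 ∨ (x.1 = -x.2 ^ 2 / 4 ∧ 0 ≤ x.2) := by
  obtain ⟨p, q⟩ := x
  simp only [apparentContour, horizon, mem_ofPred_eq, mem_univ, true_and]
  have key : ∀ y, deriv (fun y => flipModel y p q) y = p + 3 * q * y ^ 2 - 5 * y ^ 4 := by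
    intro y
    have : HasDerivAt (fun y => flipModel y p q) (p + 3 * q * y ^ 2 - 5 * y ^ 4) y := by
      unfold flipModel
      convert! (((hasDerivAt_id y).const_mul p).add ((hasDerivAt_pow 3 y).const_mul q)).sub
        (hasDerivAt_pow 5 y) using 1
      norm_num; ring
    exact this.deriv
  simp only [key]
  simp only [flipModel]
  constructor
  · rintro ⟨y, h1, h2⟩
    rcases eq_or_ne y 0 with rfl | hy
    · left; linarith
    · right
      have h3 : p + q * y ^ 2 - y ^ 4 = 0 := by
        apply mul_left_cancel₀ hy; linarith
      have h4 : q = 2 * y ^ 2 := by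
        apply mul_left_cancel₀ (pow_ne_zero 2 hy); linarith
      refine ⟨?_, by rw [h4]; positivity⟩
      rw [h4] at h3 ⊢; linarith
  · rintro (h | ⟨h1, h2⟩)
    · exact ⟨0, by simp, by simp [h]⟩
    · have h3 : √(q / 2) ^ 2 = q / 2 := Real.sq_sqrt (by positivity)
      refine ⟨√(q / 2), ?_, ?_⟩
      · have : p * √(q / 2) + q * √(q / 2) ^ 3 - √(q / 2) ^ 5 =
            √(q / 2) * (p + q * √(q / 2) ^ 2 - (√(q / 2) ^ 2) ^ 2) := by ring
        rw [this, h3, h1]; ring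
      · rw [show √(q / 2) ^ 4 = (√(q / 2) ^ 2) ^ 2 by ring, h3, h1]; ring

/-- At a flip, `p ∂³φ₀/∂y³ = 2 f' f''' - 3 f''²`. -/
lemma schwarzian_eq_zero_of_mem_flipSet {f : ℝ → ℝ} {y₀ : ℝ} {F : ℕ → ℝ → ℝ} (hF : IsJet F)
    (hfF : f =ᶠ[𝓝 y₀] F 0) (hp : 0 < F 1 y₀) (h : y₀ ∈ flipSet f) :
    2 * F 1 y₀ * F 3 y₀ - 3 * F 2 y₀ ^ 2 = 0 := by
  have h3 := h.2
  have hd : deriv f y₀ = F 1 y₀ := by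
    rw [hfF.deriv_eq]; exact (hF.hasDerivAt 0 (by norm_num) y₀).deriv
  simp only [curveLZero, hd, hfF.eq_of_nhds] at h3
  set p := F 1 y₀ with hpdef
  set q := p * y₀ + F 0 y₀ with hq
  set T : ℝ → ℝ := fun z => -(1 / p) * F 0 z + q / p with hT
  have hT0 : T y₀ = y₀ := by simp only [hT, hq]; field_simp; ring
  have hTd : ∀ z, HasDerivAt T (-(1 / p) * F 1 z) z := fun z =>
    ((hF.hasDerivAt 0 (by norm_num) z).const_mul _).add_const _
  have hd1 : ∀ i < 5, ∀ z, HasDerivAt (fun z => F i (T z))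
      (F (i + 1) (T z) * (-(1 / p) * F 1 z)) z := fun i hi z =>
    (hF.hasDerivAt i hi (T z)).comp z (hTd z)
  have heq : (fun z => phiZero f z p q) =ᶠ[𝓝 y₀] fun z => -p * z + q - F 0 (T z) := by
    have h1 : ∀ᶠ z in 𝓝 y₀, f (T z) = F 0 (T z) := by
      have : Tendsto T (𝓝 y₀) (𝓝 y₀) := by
        have := (hTd y₀).continuousAt.tendsto; rwa [hT0] at this
      exact this.eventually hfF
    filter_upwards [hfF, h1] with z hz hz1
    simp only [phiZero]
    rw [hz, ← hz1]
  rw [heq.iteratedDeriv_eq, iteratedDeriv_eq_iterate] at h3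
  have e1 : deriv (fun z => -p * z + q - F 0 (T z)) =
      fun z => -p + 1 / p * (F 1 (T z) * F 1 z) := by
    funext z
    have := (((hasDerivAt_id z).const_mul (-p)).add_const q).sub (hd1 0 (by norm_num) z)
    refine HasDerivAt.deriv ?_
    convert! this using 1
    simp; ring
  have e2 : deriv (fun z => -p + 1 / p * (F 1 (T z) * F 1 z)) =
      fun z => 1 / p * (F 2 (T z) * (-(1 / p) * F 1 z) * F 1 z + F 1 (T z) * F 2 z) := by
    funext z
    exact ((((hd1 1 (by norm_num) z).mul (hF.hasDerivAt 1 (by norm_num) z)).const_mul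
      (1 / p)).const_add (-p)).deriv
  have e3 : HasDerivAt
      (fun z => 1 / p * (F 2 (T z) * (-(1 / p) * F 1 z) * F 1 z + F 1 (T z) * F 2 z))
      (1 / p * ((F 3 y₀ * (-(1 / p) * F 1 y₀) * (-(1 / p) * F 1 y₀) + F 2 y₀ *
        (-(1 / p) * F 2 y₀)) * F 1 y₀ + F 2 y₀ * (-(1 / p) * F 1 y₀) * F 2 y₀ +
        (F 2 y₀ * (-(1 / p) * F 1 y₀) * F 2 y₀ + F 1 y₀ * F 3 y₀))) y₀ := by
    have a1 := hd1 1 (by norm_num) y₀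
    have a2 := hd1 2 (by norm_num) y₀
    have b1 := hF.hasDerivAt 1 (by norm_num) y₀
    have b2 := hF.hasDerivAt 2 (by norm_num) y₀
    convert! (((a2.mul (b1.const_mul (-(1 / p)))).mul b1).add (a1.mul b2)).const_mul (1 / p) using 1
    simp only [hT0, Pi.mul_apply]
  simp only [Function.iterate_succ, Function.iterate_zero, Function.comp_apply, id] at h3
  rw [e1, e2, e3.deriv, ← hpdef] at h3
  field_simp at h3
  linear_combination h3

/-- A function that is `C⁵` on `[-1, 1]` coincides near an interior point with a function that is
`C⁵` on the whole line. -/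
lemma exists_isJet_eventuallyEq {f : ℝ → ℝ} (hf : ContDiffOn ℝ 5 f (Icc (-1) 1)) {y₀ : ℝ}
    (hy₀ : y₀ ∈ Ioo (-1 : ℝ) 1) : ∃ F : ℕ → ℝ → ℝ, IsJet F ∧ f =ᶠ[𝓝 y₀] F 0 := by
  obtain ⟨χ, hχ⟩ : ∃ χ : ContDiffBump y₀, Metric.closedBall y₀ χ.rOut ⊆ Ioo (-1) 1 := by
    obtain ⟨ε, hε, h⟩ := Metric.isOpen_iff.1 isOpen_Ioo y₀ hy₀
    exact ⟨⟨ε / 4, ε / 2, by positivity, by linarith⟩,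
      (Metric.closedBall_subset_ball (by simp; linarith)).trans h⟩
  have hg : ContDiff ℝ 5 (fun x => χ x * f x) := by
    refine contDiff_iff_contDiffAt.2 fun x => ?_
    by_cases hx : x ∈ tsupport χ
    · rw [χ.tsupport_eq] at hx
      have : ContDiffAt ℝ 5 f x := hf.contDiffAt (Icc_mem_nhds (hχ hx).1 (hχ hx).2)
      exact χ.contDiffAt.mul this
    · refine (contDiffAt_const (c := (0 : ℝ))).congr_of_eventuallyEq ?_
      filter_upwards [notMem_tsupport_iff_eventuallyEq.1 hx] with z hz
      simp [hz]
  refine ⟨fun i => iteratedDeriv i (fun x => χ x * f x), ⟨fun i hi x => ?_, ?_⟩, ?_⟩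
  · rw [iteratedDeriv_succ]
    exact ((hg.differentiable_iteratedDeriv i (by exact_mod_cast hi)) x).hasDerivAt
  · exact hg.continuous_iteratedDeriv 5 le_rfl
  · filter_upwards [χ.eventuallyEq_one] with x hx
    simp [hx]

/-! ### The normal form at a nondegenerate flip -/

/-- `{y, z}` is a cycle (a fixed point if `y = z`) of multiplier `1` of the second iterate of
`x ↦ (q - f(x)) / p`, where `d` is the derivative of `f`. -/
def IsDegenerateCycle (f d : ℝ → ℝ) (p q y z : ℝ) : Prop :=
  f y + p * z = q ∧ f z + p * y = q ∧ d y * d z = p ^ 2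

lemma exists_continuous_eqOn_Icc {f : ℝ → ℝ} {a b : ℝ} (hab : a ≤ b)
    (hf : ContinuousOn f (Icc a b)) : ∃ g, Continuous g ∧ EqOn g f (Icc a b) :=
  ⟨IccExtend hab ((Icc a b).domRestrict f), hf.domRestrict.Icc_extend', fun x hx => by
    rw [IccExtend_of_mem hab _ hx]; rfl⟩

/-- If `{y₀}` is the only degenerate cycle in `[-1, 1]` of the parameter `x₀`, all degenerate cycles
of nearby parameters are close to `y₀`. -/
lemma eventually_forall_isDegenerateCycle {f d : ℝ → ℝ} (hf : ContinuousOn f (Icc (-1) 1))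
    (hd : ContinuousOn d (Icc (-1) 1)) {y₀ : ℝ} {x₀ : ℝ × ℝ}
    (huniq : ∀ y ∈ Icc (-1 : ℝ) 1, ∀ z ∈ Icc (-1 : ℝ) 1, IsDegenerateCycle f d x₀.1 x₀.2 y z →
      y = y₀ ∧ z = y₀) {P : ℝ × ℝ → Prop} (hP : ∀ᶠ v in 𝓝 (y₀, y₀), P v) :
    ∀ᶠ x in 𝓝 x₀, ∀ y ∈ Icc (-1 : ℝ) 1, ∀ z ∈ Icc (-1 : ℝ) 1,
      IsDegenerateCycle f d x.1 x.2 y z → P (y, z) := by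
  obtain ⟨f₁, hf₁, hff⟩ := exists_continuous_eqOn_Icc (by norm_num) hf
  obtain ⟨d₁, hd₁, hdd⟩ := exists_continuous_eqOn_Icc (by norm_num) hd
  obtain ⟨W, hW, hWo, h0W⟩ := eventually_nhds_iff.1 hP
  have hK : IsCompact ((Icc (-1 : ℝ) 1 ×ˢ Icc (-1 : ℝ) 1) \ W) :=
    (isCompact_Icc.prod isCompact_Icc).diff hWo
  have key := hK.eventually_forall_of_forall_eventually (x₀ := x₀)
    (P := fun x v => ¬ IsDegenerateCycle f₁ d₁ x.1 x.2 v.1 v.2) ?_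
  · filter_upwards [key] with x hx y hy z hz hyz
    by_contra hn
    refine hx (y, z) ⟨⟨hy, hz⟩, fun h => hn (hW _ h)⟩ ?_
    simpa [IsDegenerateCycle, hff hy, hff hz, hdd hy, hdd hz] using hyz
  · rintro ⟨y, z⟩ ⟨⟨hy, hz⟩, hn⟩
    set Θ : (ℝ × ℝ) × ℝ × ℝ → ℝ × ℝ × ℝ := fun w =>
      (f₁ w.2.1 + w.1.1 * w.2.2 - w.1.2, f₁ w.2.2 + w.1.1 * w.2.1 - w.1.2,
        d₁ w.2.1 * d₁ w.2.2 - w.1.1 ^ 2)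
    have hΘ : Continuous Θ := by simp only [Θ]; fun_prop
    have hne : Θ (x₀, y, z) ≠ 0 := by
      intro h
      simp only [Θ, Prod.mk_eq_zero, sub_eq_zero] at h
      obtain ⟨rfl, rfl⟩ := huniq y hy z hz (by
        simpa [IsDegenerateCycle, hff hy, hff hz, hdd hy, hdd hz] using h)
      exact hn h0W
    filter_upwards [hΘ.continuousAt.eventually_ne hne] with w hw h
    apply hw
    simp only [Θ, Prod.mk_eq_zero, sub_eq_zero]
    exact h

lemma IsDegenerateCycle.of_chord {F : ℕ → ℝ → ℝ} (hF : IsJet F) {m t : ℝ} (y₀ : ℝ)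
    (h : foldFn F (t, m) = 0) {p q : ℝ} (hp : chordSlope F (t, m) = p)
    (hq : q - y₀ * p = cycleOffset F y₀ (t, m)) :
    IsDegenerateCycle (F 0) (F 1) p q (m + t) (m - t) := by
  have e0 := wAvg_wZero_eq (hF.hasDerivAt 0 (by norm_num)) (hF.continuous (i := 1) (by norm_num)) t m
  have e1 := add_eq_wAvg (hF.hasDerivAt 1 (by norm_num)) (hF.hasDerivAt 2 (by norm_num))
    (hF.continuous (by norm_num)) t m
  have e2 := wAvg_wZero_eq (hF.hasDerivAt 1 (by norm_num)) (hF.continuous (i := 2) (by norm_num)) t m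
  simp only [foldFn, slopeSum, trapDefect, chordSlope, chordSlopeDeriv, cycleOffset] at *
  norm_num at e1 e2 e0
  rw [hp] at h e0 e1 hq
  refine ⟨by linarith, by linarith, ?_⟩
  have a1 : F 1 (m + t) = p + t ^ 2 * wAvg wOne (F 3) (t, m) + t * wAvg wZero (F 2) (t, m) := by
    linarith
  have a2 : F 1 (m - t) = p + t ^ 2 * wAvg wOne (F 3) (t, m) - t * wAvg wZero (F 2) (t, m) := by
    linarith
  rw [a1, a2]
  linear_combination t ^ 2 * h

lemma IsDegenerateCycle.chord {F : ℕ → ℝ → ℝ} (hF : IsJet F) {m t : ℝ} (y₀ : ℝ) (ht : t ≠ 0)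
    {p q : ℝ} (h : IsDegenerateCycle (F 0) (F 1) p q (m + t) (m - t)) :
    foldFn F (t, m) = 0 ∧ chordSlope F (t, m) = p ∧ q - y₀ * p = cycleOffset F y₀ (t, m) := by
  obtain ⟨h1, h2, h3⟩ := h
  have e0 := wAvg_wZero_eq (hF.hasDerivAt 0 (by norm_num)) (hF.continuous (i := 1) (by norm_num)) t m
  have e1 := add_eq_wAvg (hF.hasDerivAt 1 (by norm_num)) (hF.hasDerivAt 2 (by norm_num))
    (hF.continuous (by norm_num)) t m
  have e2 := wAvg_wZero_eq (hF.hasDerivAt 1 (by norm_num)) (hF.continuous (i := 2) (by norm_num)) t m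
  norm_num at e1 e2 e0
  have hp : wAvg wZero (F 1) (t, m) = p := by
    apply mul_left_cancel₀ (mul_ne_zero two_ne_zero ht)
    linear_combination e0 + h1 - h2
  simp only [foldFn, slopeSum, trapDefect, chordSlope, chordSlopeDeriv, cycleOffset]
  rw [hp] at e0 e1 ⊢
  refine ⟨?_, rfl, by linarith⟩
  have a1 : F 1 (m + t) = p + t ^ 2 * wAvg wOne (F 3) (t, m) + t * wAvg wZero (F 2) (t, m) := by
    linarith
  have a2 : F 1 (m - t) = p + t ^ 2 * wAvg wOne (F 3) (t, m) - t * wAvg wZero (F 2) (t, m) := by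
    linarith
  rw [a1, a2] at h3
  apply mul_left_cancel₀ (pow_ne_zero 2 ht)
  linear_combination h3

/-- A shear composed with `C¹` changes of the single coordinates is a local `C¹` diffeomorphism. -/
lemma exists_openPartialHomeomorph_shear {φ Q : ℝ → ℝ} {α φ' Q' s : ℝ} {x₀ : ℝ × ℝ}
    (hα : α ^ 2 = 1) (hφ : ContDiffAt ℝ 1 φ (x₀.2 - s * x₀.1))
    (hφ' : HasDerivAt φ φ' (x₀.2 - s * x₀.1)) (hQ : ContDiffAt ℝ 1 Q (x₀.2 - s * x₀.1))
    (hQ' : HasDerivAt Q Q' (x₀.2 - s * x₀.1)) (h0 : Q' ≠ 0) :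
    ∃ h : OpenPartialHomeomorph (ℝ × ℝ) (ℝ × ℝ), x₀ ∈ h.source ∧
      (∀ x, h x = (α * (x.1 - φ (x.2 - s * x.1)), Q (x.2 - s * x.1))) ∧
      ContDiffOn ℝ 1 h h.source ∧ ContDiffOn ℝ 1 h.symm h.target := by
  set r : ℝ × ℝ →L[ℝ] ℝ := .snd ℝ ℝ ℝ - s • .fst ℝ ℝ ℝ with hr
  set u : ℝ × ℝ →L[ℝ] ℝ := α • .fst ℝ ℝ ℝ + (φ' * Q'⁻¹) • .snd ℝ ℝ ℝ with hu
  set L : (ℝ × ℝ) ≃L[ℝ] (ℝ × ℝ) := ContinuousLinearEquiv.equivOfInverse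
    ((α • (.fst ℝ ℝ ℝ - φ' • r)).prod (Q' • r)) (u.prod (Q'⁻¹ • .snd ℝ ℝ ℝ + s • u))
    (by
      intro v
      ext
      · simp [hu, hr]
        field_simp
        linear_combination (v.1 - φ' * (v.2 - s * v.1)) * hα
      · simp [hu, hr]
        field_simp
        linear_combination s * (v.1 - φ' * (v.2 - s * v.1)) * hα)
    (by
      intro v
      ext
      · simp [hu, hr]
        field_simp
        linear_combination v.1 * Q' * hα
      · simp [hu, hr]
        field_simp
        ring) with hL
  set H : ℝ × ℝ → ℝ × ℝ := fun x => (α * (x.1 - φ (x.2 - s * x.1)), Q (x.2 - s * x.1)) with hH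
  have hrd : ContDiff ℝ 1 fun x : ℝ × ℝ => x.2 - s * x.1 := by fun_prop
  have hH1 : ContDiffAt ℝ 1 H x₀ :=
    (contDiffAt_const.mul (contDiffAt_fst.sub (ContDiffAt.comp x₀ hφ hrd.contDiffAt))).prodMk
      (ContDiffAt.comp x₀ hQ hrd.contDiffAt)
  have hH2 : HasFDerivAt H (L : ℝ × ℝ →L[ℝ] ℝ × ℝ) x₀ := by
    have hr' : HasFDerivAt (fun x : ℝ × ℝ => x.2 - s * x.1) r x₀ :=
      hasFDerivAt_snd.sub (hasFDerivAt_fst.const_mul s)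
    have h1 := hφ'.comp_hasFDerivAt x₀ hr'
    have h2 := hQ'.comp_hasFDerivAt x₀ hr'
    exact ((hasFDerivAt_fst.sub h1).const_mul α).prodMk h2
  obtain ⟨h, h1, h2, h3, h4⟩ := exists_openPartialHomeomorph_contDiffOn hH1 hH2
  exact ⟨h, h1, fun x => by rw [h2], h3, h4⟩

/-- The local statement: `h(p, q) = (α (p - φ(R)), Q(R))` with `R = q - y₀ p`, where `p = φ(R)` is
the equation of `L₀` and `Q` is chosen such that the curve of degenerate 2-cycles becomes
`p = -q² / 4`, `q ≥ 0`. -/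
theorem exists_flip_normalForm {f d : ℝ → ℝ} (hf : ContinuousOn f (Icc (-1) 1))
    (hd : ContinuousOn d (Icc (-1) 1)) (hfd : ∀ y ∈ Ioo (-1 : ℝ) 1, HasDerivAt f (d y) y)
    (hdpos : ∀ y ∈ Icc (-1 : ℝ) 1, 0 < d y) {y₀ : ℝ} (hy₀ : y₀ ∈ Ioo (-1 : ℝ) 1)
    {F : ℕ → ℝ → ℝ} (hF : IsJet F) (hfF : f =ᶠ[𝓝 y₀] F 0)
    (hN : 2 * F 1 y₀ * F 3 y₀ - 3 * F 2 y₀ ^ 2 = 0)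
    (hN' : 2 * F 1 y₀ * F 4 y₀ - 4 * F 2 y₀ * F 3 y₀ ≠ 0)
    (hC : 2 * F 1 y₀ ^ 3 * F 5 y₀ - 15 * F 1 y₀ ^ 2 * F 2 y₀ * F 4 y₀ + 30 * F 2 y₀ ^ 4 ≠ 0)
    (hiso : ∀ y ∈ Icc (-1 : ℝ) 1, ∀ z ∈ Icc (-1 : ℝ) 1,
      IsDegenerateCycle f d (d y₀) (d y₀ * y₀ + f y₀) y z → y = z) :
    ∃ h : OpenPartialHomeomorph (ℝ × ℝ) (ℝ × ℝ),
      curveLZero f y₀ ∈ h.source ∧ h (curveLZero f y₀) = (0, 0) ∧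
      ContDiffOn ℝ 1 h h.source ∧ ContDiffOn ℝ 1 h.symm h.target ∧
      (∀ U ∈ 𝓝 y₀, ∀ᶠ x in 𝓝 (curveLZero f y₀),
        x ∈ apparentContour (phiZeroDomain f) (phiZero f) U ↔
          h x ∈ apparentContour univ flipModel univ) ∧
      (∀ᶠ x in 𝓝 (curveLZero f y₀), x ∈ curveLZero f '' Ioo (-1) 1 ↔ (h x).1 = 0) := by
  have hIoo : ∀ᶠ y in 𝓝 y₀, y ∈ Ioo (-1 : ℝ) 1 := Ioo_mem_nhds hy₀.1 hy₀.2
  have hdF : ∀ᶠ y in 𝓝 y₀, d y = F 1 y := by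
    filter_upwards [hfF.eventually_nhds, hIoo] with y h1 h2
    exact (hfd y h2).unique ((hF.hasDerivAt 0 (by norm_num) y).congr_of_eventuallyEq h1)
  have hdy₀ : d y₀ = F 1 y₀ := hdF.self_of_nhds
  have hfy₀ : f y₀ = F 0 y₀ := hfF.eq_of_nhds
  have hp : 0 < F 1 y₀ := hdy₀ ▸ hdpos y₀ (Ioo_subset_Icc_self hy₀)
  have hL : ∀ y ∈ Ioo (-1 : ℝ) 1, curveLZero f y = (d y, d y * y + f y) := fun y hy => by
    simp only [curveLZero, (hfd y hy).deriv]
  set x₀ : ℝ × ℝ := curveLZero f y₀ with hx₀def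
  have hx₀ : x₀ = (F 1 y₀, F 1 y₀ * y₀ + F 0 y₀) := by rw [hx₀def, hL y₀ hy₀, hdy₀, hfy₀]
  have hmono : StrictMonoOn f (Icc (-1) 1) := by
    refine strictMonoOn_of_deriv_pos (convex_Icc _ _) hf fun y hy => ?_
    rw [interior_Icc] at hy
    rw [(hfd y hy).deriv]
    exact hdpos y (Ioo_subset_Icc_self hy)
  have huniq : ∀ y ∈ Icc (-1 : ℝ) 1, ∀ z ∈ Icc (-1 : ℝ) 1,
      IsDegenerateCycle f d x₀.1 x₀.2 y z → y = y₀ ∧ z = y₀ := by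
    intro y hy z hz h
    rw [hx₀def, hL y₀ hy₀] at h
    have := hiso y hy z hz h
    subst this
    have h1 := h.1
    have hpp : 0 < d y₀ := hdpos y₀ (Ioo_subset_Icc_self hy₀)
    simp only at h1
    have : y = y₀ := by
      rcases lt_trichotomy y y₀ with h2 | h2 | h2
      · have := hmono hy (Ioo_subset_Icc_self hy₀) h2
        nlinarith
      · exact h2
      · have := hmono (Ioo_subset_Icc_self hy₀) hy h2
        nlinarith
    exact ⟨this, this⟩
  obtain ⟨e, M, b, c, α, b', c', hes, he, hesymm, hM0, hMc, hMz, hMu, hα, hb1, hb2, hb0, hc1, hc2,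
    hc0, hcz, hbc⟩ := hF.exists_foldCurve_normalForm hp hN hN' hC
  obtain ⟨eb, heb0, heb, -, hebsymm⟩ := exists_openPartialHomeomorph_real hb1 hb2 hb0
  set R : ℝ × ℝ → ℝ := fun x => x.2 - y₀ * x.1 with hR
  have hRc : Continuous R := by simp only [hR]; fun_prop
  have hRx₀ : R x₀ = F 0 y₀ := by simp only [hR, hx₀]; ring
  have hey₀ : e y₀ = R x₀ := by rw [hRx₀, he]; simp [flipOffset]
  have hb00 : b 0 = R x₀ := by
    have h1 := (hbc.self_of_nhdsWithin self_mem_Ici).1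
    simp only [hM0, cycleOffset] at h1
    rw [hRx₀]
    simpa using h1
  have het : R x₀ ∈ e.target := hey₀ ▸ e.map_source hes
  have hesx : e.symm (R x₀) = y₀ := by rw [← hey₀, e.left_inv hes]
  have hebt : R x₀ ∈ eb.target := by
    rw [← hb00, ← heb]; exact eb.map_source heb0
  have hebx : eb.symm (R x₀) = 0 := by rw [← hb00, ← heb, eb.left_inv heb0]
  have hφ1 : ContDiffAt ℝ 1 (fun r => F 1 (e.symm r)) (R x₀) := by
    refine ContDiffAt.comp (g := F 1) _ (contDiffAt_one_of_hasDerivAt (f' := F 2)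
      (Eventually.of_forall fun y => ⟨hF.hasDerivAt 1 (by norm_num) y,
        (hF.continuous (by norm_num)).continuousAt⟩)) ?_
    exact hesymm.contDiffAt (e.open_target.mem_nhds het)
  have hQ1 : ContDiffAt ℝ 1 (fun r => c (eb.symm r)) (R x₀) :=
    ContDiffAt.comp (g := c) _ (by rw [hebx]; exact hc1)
      (hebsymm.contDiffAt (eb.open_target.mem_nhds hebt))
  have hQ2 : HasDerivAt (fun r => c (eb.symm r)) (c' * b'⁻¹) (R x₀) := by
    refine HasDerivAt.comp (h₂ := c) _ (by rw [hebx]; exact hc2) ?_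
    exact eb.hasDerivAt_symm hebt hb0 (by rw [hebx, heb]; exact hb2)
  obtain ⟨h, hh0, hh, hh1, hh2⟩ := exists_openPartialHomeomorph_shear hα hφ1
    (hφ1.differentiableAt (by simp)).hasDerivAt hQ1 hQ2 (mul_ne_zero hc0.ne' (inv_ne_zero hb0))
  have hh' : ∀ x, h x = (α * (x.1 - F 1 (e.symm (R x))), c (eb.symm (R x))) := hh
  have hα0 : α ≠ 0 := by rintro rfl; norm_num at hα
  -- `c` has the sign of its argument
  have hcsign : ∀ᶠ s in 𝓝 (0 : ℝ), (0 ≤ s → 0 ≤ c s) ∧ (0 < c s → 0 < s) := by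
    have h1 := (hasDerivAt_iff_tendsto_slope.1 hc2).eventually (eventually_gt_nhds hc0)
    rw [eventually_nhdsWithin_iff] at h1
    filter_upwards [h1] with s hs
    rcases eq_or_ne s 0 with rfl | h0
    · simp [hcz]
    · have h2 := hs h0
      simp only [slope_def_field, hcz, sub_zero] at h2
      constructor
      · intro h3
        by_contra h4
        exact absurd h2 (not_lt.2 (div_nonpos_of_nonpos_of_nonneg (not_le.1 h4).le h3))
      · intro h3
        by_contra h4
        exact absurd h2 (not_lt.2 (div_nonpos_of_nonneg_of_nonpos h3.le (not_lt.1 h4)))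
  have hbc' : ∀ᶠ t in 𝓝 (0 : ℝ), 0 ≤ t → b (t ^ 2) = cycleOffset F y₀ (t, M t) ∧
      α * (chordSlope F (t, M t) - F 1 (e.symm (cycleOffset F y₀ (t, M t)))) =
        -(c (t ^ 2)) ^ 2 / 4 := by
    exact eventually_nhdsWithin_iff.1 hbc
  have hsq : Tendsto (fun t : ℝ => t ^ 2) (𝓝 0) (𝓝 0) := by
    have := (continuous_pow (M := ℝ) 2).tendsto 0
    simpa using this
  -- what has to be known about a degenerate cycle `{y, z}` close to `y₀`
  have hgood : ∀ U ∈ 𝓝 y₀, ∀ᶠ v in 𝓝 (y₀, y₀), (v.1 ∈ U ∧ v.1 ∈ Ioo (-1 : ℝ) 1 ∧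
      v.2 ∈ Ioo (-1 : ℝ) 1) ∧ (f v.1 = F 0 v.1 ∧ f v.2 = F 0 v.2) ∧
      (d v.1 = F 1 v.1 ∧ d v.2 = F 1 v.2) ∧ v.1 ∈ e.source := by
    intro U hU
    have t1 : Tendsto Prod.fst (𝓝 (y₀, y₀)) (𝓝 y₀) := continuous_fst.tendsto (y₀, y₀)
    have t2 : Tendsto Prod.snd (𝓝 (y₀, y₀)) (𝓝 y₀) := continuous_snd.tendsto (y₀, y₀)
    filter_upwards [t1.eventually hU, t1.eventually hIoo, t2.eventually hIoo, t1.eventually hfF,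
      t2.eventually hfF, t1.eventually hdF, t2.eventually hdF,
      t1.eventually (e.open_source.mem_nhds hes)] with v h1 h2 h3 h4 h5 h6 h7 h8
    exact ⟨⟨h1, h2, h3⟩, ⟨h4, h5⟩, ⟨h6, h7⟩, h8⟩
  have hpair : ∀ᶠ v in 𝓝 (y₀, y₀), ∀ t m : ℝ, 0 < t →
      (v = (m + t, m - t) ∨ v = (m - t, m + t)) → (foldFn F (t, m) = 0 → M t = m) ∧
      (b (t ^ 2) = cycleOffset F y₀ (t, M t) ∧
        α * (chordSlope F (t, M t) - F 1 (e.symm (cycleOffset F y₀ (t, M t)))) =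
          -(c (t ^ 2)) ^ 2 / 4) ∧ 0 ≤ c (t ^ 2) ∧ t ^ 2 ∈ eb.source := by
    have t1 : Tendsto (fun v : ℝ × ℝ => |v.1 - v.2| / 2) (𝓝 (y₀, y₀)) (𝓝 0) := by
      have : Continuous fun v : ℝ × ℝ => |v.1 - v.2| / 2 := by fun_prop
      simpa using this.tendsto (y₀, y₀)
    have t2 : Tendsto (fun v : ℝ × ℝ => (v.1 + v.2) / 2) (𝓝 (y₀, y₀)) (𝓝 y₀) := by
      have : Continuous fun v : ℝ × ℝ => (v.1 + v.2) / 2 := by fun_prop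
      simpa using this.tendsto (y₀, y₀)
    have t3 := t1.prodMk_nhds t2
    filter_upwards [t3.eventually hMu, t1.eventually hbc', (hsq.comp t1).eventually hcsign,
      (hsq.comp t1).eventually (eb.open_source.mem_nhds heb0)] with v h1 h2 h3 h4 t m ht hv
    have ev : |v.1 - v.2| / 2 = t ∧ (v.1 + v.2) / 2 = m := by
      rcases hv with rfl | rfl
      · refine ⟨?_, by ring⟩
        rw [show (m + t, m - t).1 - (m + t, m - t).2 = 2 * t by ring, abs_of_pos (by linarith)]
        ring
      · refine ⟨?_, by ring⟩
        rw [show (m - t, m + t).1 - (m - t, m + t).2 = -(2 * t) by ring, abs_neg,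
          abs_of_pos (by linarith)]
        ring
    simp only [Function.comp_apply, ev.1, ev.2] at h1 h2 h3 h4
    exact ⟨h1, h2 ht.le, h3.1 (by positivity), h4⟩
  -- flips are mapped to the line
  have hflip : ∀ x : ℝ × ℝ, ∀ y, y ∈ e.source → x.1 = F 1 y → x.2 = F 1 y * y + F 0 y →
      (h x).1 = 0 := by
    intro x y hye h1 h2
    have : R x = e y := by simp only [hR, he, flipOffset]; rw [h1, h2]; ring
    simp only [hh', this, e.left_inv hye, h1, sub_self, mul_zero]
  have hx₀' : Tendsto R (𝓝 x₀) (𝓝 (R x₀)) := hRc.tendsto x₀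
  have hYt : Tendsto (fun x => e.symm (R x)) (𝓝 x₀) (𝓝 y₀) := by
    have := (e.continuousAt_symm het).tendsto
    rw [hesx] at this
    exact this.comp hx₀'
  have hst : Tendsto (fun x => eb.symm (R x)) (𝓝 x₀) (𝓝 0) := by
    have := (eb.continuousAt_symm hebt).tendsto
    rw [hebx] at this
    exact this.comp hx₀'
  have htt : Tendsto (fun x => √(eb.symm (R x))) (𝓝 x₀) (𝓝 0) := by
    have := hst.sqrt
    simpa using this
  have hmt : Tendsto (fun x => M (√(eb.symm (R x)))) (𝓝 x₀) (𝓝 y₀) := by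
    have := hMc.tendsto
    rw [hM0] at this
    exact this.comp htt
  have hx1 : ∀ᶠ x in 𝓝 x₀, 0 < x.1 := by
    refine (continuous_fst.tendsto x₀).eventually (eventually_gt_nhds ?_)
    rw [hx₀]; exact hp
  -- points of the line come from flips close to `y₀`
  have hline : ∀ U ∈ 𝓝 y₀, ∀ᶠ x in 𝓝 x₀, (h x).1 = 0 →
      ∃ y ∈ U, y ∈ Ioo (-1 : ℝ) 1 ∧ x = (d y, d y * y + f y) := by
    intro U hU
    filter_upwards [hYt.eventually hU, hYt.eventually hIoo, hYt.eventually hfF,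
      hYt.eventually hdF, hx₀'.eventually (e.open_target.mem_nhds het)] with x h1 h2 h3 h4 h5 hx
    refine ⟨e.symm (R x), h1, h2, ?_⟩
    simp only [hh', mul_eq_zero, hα0, false_or, sub_eq_zero] at hx
    have h6 : flipOffset F y₀ (e.symm (R x)) = R x := by rw [← he]; exact e.right_inv h5
    simp only [flipOffset, ← hx] at h6
    ext
    · simp only [h4, hx]
    · simp only [h3, h4, ← hx]
      have h7 : R x = x.2 - y₀ * x.1 := rfl
      linarith
  refine ⟨h, hh0, ?_, hh1, hh2, ?_, ?_⟩
  · rw [hh', hesx, hebx, hcz, hx₀]; simp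
  · intro U hU
    have hsplit : ∀ᶠ x in 𝓝 x₀, 0 < eb.symm (R x) →
        ((M (√(eb.symm (R x))) + √(eb.symm (R x)) ∈ U ∧
          M (√(eb.symm (R x))) + √(eb.symm (R x)) ∈ Ioo (-1 : ℝ) 1 ∧
          M (√(eb.symm (R x))) - √(eb.symm (R x)) ∈ Ioo (-1 : ℝ) 1)) ∧
        (f (M (√(eb.symm (R x))) + √(eb.symm (R x))) =
            F 0 (M (√(eb.symm (R x))) + √(eb.symm (R x))) ∧
          f (M (√(eb.symm (R x))) - √(eb.symm (R x))) =
            F 0 (M (√(eb.symm (R x))) - √(eb.symm (R x)))) ∧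
        (d (M (√(eb.symm (R x))) + √(eb.symm (R x))) =
            F 1 (M (√(eb.symm (R x))) + √(eb.symm (R x))) ∧
          d (M (√(eb.symm (R x))) - √(eb.symm (R x))) =
            F 1 (M (√(eb.symm (R x))) - √(eb.symm (R x)))) := by
      have s1 := hmt.add htt
      have s2 := hmt.sub htt
      rw [add_zero] at s1
      rw [sub_zero] at s2
      filter_upwards [(s1.prodMk_nhds s2).eventually (hgood U hU)] with x hx _
      exact ⟨hx.1, hx.2.1, hx.2.2.1⟩
    filter_upwards [eventually_forall_isDegenerateCycle hf hd huniq ((hgood U hU).and hpair),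
      hx1, hline U hU, hsplit, hst.eventually hcsign, htt.eventually hbc', htt.eventually hMz,
      hx₀'.eventually (eb.open_target.mem_nhds hebt)]
      with x hcyc hxp hlx hsp hcs hbcx hMx hRx
    rw [mem_apparentContour_phiZero hfd, mem_apparentContour_flipModel]
    constructor
    · rintro ⟨y, hyU, z, -, hy, hz, h1, h2, h3⟩
      obtain ⟨⟨-, ⟨ey, ez⟩, ⟨dy, dz⟩, hye⟩, hpr⟩ := hcyc y (Ioo_subset_Icc_self hy) z
        (Ioo_subset_Icc_self hz) ⟨h1, h2, h3⟩
      have hdeg : IsDegenerateCycle (F 0) (F 1) x.1 x.2 y z := by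
        rw [ey] at h1; rw [ez] at h2; rw [dy, dz] at h3
        exact ⟨h1, h2, h3⟩
      rcases eq_or_ne y z with rfl | hyz
      · left
        have hpos : 0 < F 1 y := dy ▸ hdpos y (Ioo_subset_Icc_self hy)
        have e1 : x.1 = F 1 y := by
          have := hdeg.2.2
          nlinarith
        exact hflip x y hye e1 (by rw [← hdeg.1, e1]; ring)
      · right
        obtain ⟨t, m, ht, hv, hdeg'⟩ : ∃ t m : ℝ, 0 < t ∧
            ((y, z) = (m + t, m - t) ∨ (y, z) = (m - t, m + t)) ∧
            IsDegenerateCycle (F 0) (F 1) x.1 x.2 (m + t) (m - t) := by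
          rcases lt_or_gt_of_ne hyz with hlt | hlt
          · refine ⟨(z - y) / 2, (y + z) / 2, by linarith, Or.inr ?_, ?_⟩
            · ext <;> simp <;> ring
            · rw [show (y + z) / 2 + (z - y) / 2 = z by ring,
                show (y + z) / 2 - (z - y) / 2 = y by ring]
              exact ⟨hdeg.2.1, hdeg.1, by rw [mul_comm]; exact hdeg.2.2⟩
          · refine ⟨(y - z) / 2, (y + z) / 2, by linarith, Or.inl ?_, ?_⟩
            · ext <;> simp <;> ring
            · rw [show (y + z) / 2 + (y - z) / 2 = y by ring,
                show (y + z) / 2 - (y - z) / 2 = z by ring]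
              exact hdeg
        obtain ⟨g1, ⟨g2, g3⟩, g4, g5⟩ := hpr t m ht hv
        obtain ⟨k1, k2, k3⟩ := hdeg'.chord hF y₀ ht.ne'
        rw [g1 k1] at g2 g3
        have hRb : R x = b (t ^ 2) := by rw [g2]; exact k3
        have hs : eb.symm (R x) = t ^ 2 := by rw [hRb, ← heb, eb.left_inv g5]
        have hRo : R x = cycleOffset F y₀ (t, m) := k3
        rw [hh', hs]
        refine ⟨?_, g4⟩
        rw [hRo, ← k2]
        exact g3
    · intro hx
      have hcase : (h x).1 = 0 ∨ ((h x).1 = -(h x).2 ^ 2 / 4 ∧ 0 < (h x).2) := by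
        rcases hx with hx | ⟨h1, h2⟩
        · exact Or.inl hx
        · rcases h2.eq_or_lt with h3 | h3
          · left; rw [h1, ← h3]; norm_num
          · exact Or.inr ⟨h1, h3⟩
      rcases hcase with hx | ⟨h1, h2⟩
      · obtain ⟨y, hyU, hy, hxy⟩ := hlx hx
        refine ⟨y, hyU, y, hxp, hy, hy, ?_, ?_, ?_⟩ <;> rw [hxy] <;> ring
      · rw [hh'] at h1 h2
        simp only at h1 h2
        have hs := hcs.2 h2
        obtain ⟨⟨u1, u2, u3⟩, ⟨v1, v2⟩, w1, w2⟩ := hsp hs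
        obtain ⟨g1, g2⟩ := hbcx (Real.sqrt_nonneg _)
        rw [Real.sq_sqrt hs.le] at g1 g2
        rw [← heb, eb.right_inv hRx] at g1
        rw [← g1, ← h1] at g2
        have hpe := mul_left_cancel₀ hα0 g2
        have := IsDegenerateCycle.of_chord hF y₀ hMx (sub_left_injective hpe) g1
        refine ⟨_, u1, _, hxp, u2, u3, ?_⟩
        rw [v1, v2, w1, w2]
        exact this
  · filter_upwards [eventually_forall_isDegenerateCycle hf hd huniq (hgood univ univ_mem),
      hline univ univ_mem] with x hcyc hlx
    constructor
    · rintro ⟨y, hy, hxy⟩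
      rw [hL y hy] at hxy
      obtain ⟨-, ⟨ey, -⟩, ⟨dy, -⟩, hye⟩ := hcyc y (Ioo_subset_Icc_self hy) y
        (Ioo_subset_Icc_self hy) (by rw [← hxy]; exact ⟨by ring, by ring, by ring⟩)
      exact hflip x y hye (by rw [← hxy, ← dy]) (by rw [← hxy, ← dy, ← ey])
    · intro hx
      obtain ⟨y, -, hy, hxy⟩ := hlx hx
      exact ⟨y, hy, by rw [hL y hy, hxy]⟩

/-! ### The `C^k` topology and small perturbations -/

namespace SectionMap

variable {k : ℕ∞}

/-- The one-sided derivatives of `f` at `y ∈ [-1, 1]`, as a sequence. -/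
noncomputable def jet (f : SectionMap k) (y : ℝ) (j : ℕ) : ℝ :=
  iteratedDerivWithin j f.toFun (Icc (-1) 1) y

lemma uniqueDiffOn : UniqueDiffOn ℝ (Icc (-1 : ℝ) 1) := uniqueDiffOn_Icc (by norm_num)

lemma jet_zero (f : SectionMap k) (y : ℝ) : f.jet y 0 = f.toFun y := by simp [jet]

lemma jet_one (f : SectionMap k) (y : ℝ) :
    f.jet y 1 = derivWithin f.toFun (Icc (-1) 1) y := by
  simp [jet, iteratedDerivWithin_one]

lemma jet_one_pos (f : SectionMap k) {y : ℝ} (hy : y ∈ Icc (-1 : ℝ) 1) : 0 < f.jet y 1 := by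
  rw [jet_one]; exact f.deriv_pos y hy

lemma continuousOn_jet (f : SectionMap k) {j : ℕ} (hj : (j : ℕ∞) ≤ k) :
    ContinuousOn (fun y => f.jet y j) (Icc (-1) 1) :=
  f.contDiffOn.continuousOn_iteratedDerivWithin (by exact_mod_cast hj) uniqueDiffOn

lemma hasDerivWithinAt_jet (f : SectionMap k) {j : ℕ} (hj : ((j + 1 : ℕ) : ℕ∞) ≤ k) {y : ℝ}
    (hy : y ∈ Icc (-1 : ℝ) 1) :
    HasDerivWithinAt (fun y => f.jet y j) (f.jet y (j + 1)) (Icc (-1) 1) y := by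
  have h1 : (j : WithTop ℕ∞) < (k : WithTop ℕ∞) := by
    have : (j : ℕ∞) < k := lt_of_lt_of_le (by exact_mod_cast Nat.lt_succ_self j) hj
    exact_mod_cast this
  have := (f.contDiffOn.differentiableOn_iteratedDerivWithin h1 uniqueDiffOn) y hy
  simp only [jet, iteratedDerivWithin_succ]
  exact this.hasDerivWithinAt

lemma tendsto_nhds_iff {ι : Type*} {l : Filter ι} {g : ι → SectionMap k} {f : SectionMap k} :
    Tendsto g l (𝓝 f) ↔ ∀ j : ℕ, (j : ℕ∞) ≤ k →
      TendstoUniformly (fun a (y : Icc (-1 : ℝ) 1) => (g a).jet y j) (fun y => f.jet y j) l := by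
  rw [nhds_induced, tendsto_comap_iff, tendsto_pi_nhds]
  simp only [UniformFun.tendsto_iff_tendstoUniformly, Subtype.forall]
  rfl

/-- The derivatives of order at most `k` depend jointly continuously on the function and the
point. -/
lemma continuous_jet {j : ℕ} (hj : (j : ℕ∞) ≤ k) :
    Continuous fun v : SectionMap k × Icc (-1 : ℝ) 1 => v.1.jet v.2 j := by
  rw [continuous_iff_continuousAt]
  rintro ⟨f, y⟩
  have h1 : TendstoUniformly (fun (v : SectionMap k × Icc (-1 : ℝ) 1) (y : Icc (-1 : ℝ) 1) =>
      v.1.jet y j) (fun y => f.jet y j) (𝓝 (f, y)) :=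
    tendsto_nhds_iff.1 (continuous_fst.tendsto (f, y)) j hj
  exact h1.tendsto_comp (f.continuousOn_jet hj).domRestrict.continuousAt
    (continuous_snd.tendsto (f, y))

/-- The derivatives of a linear perturbation. -/
lemma iteratedDerivWithin_add_sum (f : SectionMap k) {n : ℕ} {u : Fin n → ℝ → ℝ}
    (hu : ∀ i, ContDiffOn ℝ k (u i) (Icc (-1) 1)) (c : Fin n → ℝ) {j : ℕ} (hj : (j : ℕ∞) ≤ k)
    {y : ℝ} (hy : y ∈ Icc (-1 : ℝ) 1) :
    iteratedDerivWithin j (fun x => f.toFun x + ∑ i, c i * u i x) (Icc (-1) 1) y =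
      f.jet y j + ∑ i, c i * iteratedDerivWithin j (u i) (Icc (-1) 1) y := by
  have hj' : (j : WithTop ℕ∞) ≤ (k : WithTop ℕ∞) := by exact_mod_cast hj
  have hi : ∀ i, ContDiffWithinAt ℝ j (fun x => c i * u i x) (Icc (-1) 1) y := fun i =>
    contDiffWithinAt_const.mul ((hu i y hy).of_le hj')
  rw [iteratedDerivWithin_fun_add hy uniqueDiffOn ((f.contDiffOn y hy).of_le hj')
    (ContDiffWithinAt.sum fun i _ => hi i), iteratedDerivWithin_fun_sum hy uniqueDiffOn
    fun i _ => hi i]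
  simp only [iteratedDerivWithin_const_mul_field]
  rfl

/-- Linear perturbations with small coefficients stay in a given neighbourhood. -/
lemma eventually_exists_add_sum_mem {f : SectionMap k} (hk : 1 ≤ k) {V : Set (SectionMap k)}
    (hV : V ∈ 𝓝 f) {n : ℕ} {u : Fin n → ℝ → ℝ} (hu : ∀ i, ContDiffOn ℝ k (u i) (Icc (-1) 1))
    {ι : Type*} {l : Filter ι} {c : ι → Fin n → ℝ} (hc : Tendsto c l (𝓝 0)) :
    ∀ᶠ a in l, ∃ g ∈ V, g.toFun = fun x => f.toFun x + ∑ i, c a i * u i x := by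
  classical
  set p : ι → ℝ → ℝ := fun a x => f.toFun x + ∑ i, c a i * u i x with hp
  have hpc : ∀ a, ContDiffOn ℝ k (p a) (Icc (-1) 1) := fun a =>
    f.contDiffOn.add (ContDiffOn.sum fun i _ => contDiffOn_const.mul (hu i))
  have hunif : ∀ j : ℕ, (j : ℕ∞) ≤ k → ∀ ε > 0, ∀ᶠ a in l, ∀ y ∈ Icc (-1 : ℝ) 1,
      |iteratedDerivWithin j (p a) (Icc (-1) 1) y - f.jet y j| < ε := by
    intro j hj ε hε
    have hcont : ∀ i, ∃ C, ∀ y ∈ Icc (-1 : ℝ) 1,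
        ‖iteratedDerivWithin j (u i) (Icc (-1) 1) y‖ ≤ C := fun i =>
      isCompact_Icc.exists_bound_of_continuousOn
        ((hu i).continuousOn_iteratedDerivWithin (by exact_mod_cast hj) uniqueDiffOn)
    choose C hC using hcont
    have hlim : Tendsto (fun a => ∑ i, |c a i| * C i) l (𝓝 0) := by
      have : Tendsto (fun a => ∑ i, |c a i| * C i) l (𝓝 (∑ i, |(0 : Fin n → ℝ) i| * C i)) :=
        tendsto_finsetSum _ fun i _ => ((tendsto_pi_nhds.1 hc i).abs).mul_const _
      simpa using this
    filter_upwards [hlim.eventually (eventually_lt_nhds hε)] with a ha y hy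
    rw [iteratedDerivWithin_add_sum f hu _ hj hy, add_sub_cancel_left]
    refine lt_of_le_of_lt (Finset.abs_sum_le_sum_abs _ _) (lt_of_le_of_lt ?_ ha)
    refine Finset.sum_le_sum fun i _ => ?_
    rw [abs_mul]
    exact mul_le_mul_of_nonneg_left (hC i y hy) (abs_nonneg _)
  have hpos : ∀ᶠ a in l, ∀ y ∈ Icc (-1 : ℝ) 1, 0 < derivWithin (p a) (Icc (-1) 1) y := by
    obtain ⟨y₁, hy₁, hmin⟩ := isCompact_Icc.exists_isMinOn (nonempty_Icc.2 (by norm_num))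
      (f.continuousOn_jet (j := 1) (by exact_mod_cast hk))
    filter_upwards [hunif 1 (by exact_mod_cast hk) _ (f.jet_one_pos hy₁)] with a ha y hy
    have h1 := ha y hy
    have h2 : f.jet y₁ 1 ≤ f.jet y 1 := hmin hy
    rw [iteratedDerivWithin_one] at h1
    linarith [(abs_lt.1 h1).1]
  set g : ι → SectionMap k := fun a =>
    if h : ∀ y ∈ Icc (-1 : ℝ) 1, 0 < derivWithin (p a) (Icc (-1) 1) y then ⟨p a, hpc a, h⟩ else f
    with hg
  have hgt : Tendsto g l (𝓝 f) := by
    rw [tendsto_nhds_iff]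
    intro j hj
    rw [Metric.tendstoUniformly_iff]
    intro ε hε
    filter_upwards [hunif j hj ε hε, hpos] with a ha hpa y
    rw [dist_comm, Real.dist_eq]
    simp only [hg, dif_pos hpa]
    exact ha y y.2
  filter_upwards [hgt.eventually hV, hpos] with a ha hpa
  exact ⟨g a, ha, by simp only [hg, dif_pos hpa]; rfl⟩

end SectionMap

/-! ### Nondegeneracy of the flips is generic -/

/-- The numerator `2 f' f''' - 3 f''²` of the Schwarzian derivative, as a function of the jet. -/
def schwarzianNum (J : ℕ → ℝ) : ℝ := 2 * J 1 * J 3 - 3 * J 2 ^ 2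

/-- The derivative of `schwarzianNum` along a jet. -/
def schwarzianNumDeriv (J : ℕ → ℝ) : ℝ := 2 * J 1 * J 4 - 4 * J 2 * J 3

/-- The expression in the jet whose vanishing, where the Schwarzian derivative vanishes, makes the
flip more degenerate than the model. -/
def flipFoldNum (J : ℕ → ℝ) : ℝ := 2 * J 1 ^ 3 * J 5 - 15 * J 1 ^ 2 * J 2 * J 4 + 30 * J 2 ^ 4

lemma isOpen_forall_ne_zero {X Y E : Type*} [TopologicalSpace X] [TopologicalSpace Y]
    [CompactSpace Y] [TopologicalSpace E] [T1Space E] [Zero E] {Θ : X × Y → E}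
    (hΘ : Continuous Θ) : IsOpen {x | ∀ y, Θ (x, y) ≠ 0} := by
  rw [isOpen_iff_eventually]
  intro x hx
  have := isCompact_univ.eventually_forall_of_forall_eventually (x₀ := x)
    (P := fun (x : X) (y : Y) => Θ (x, y) ≠ 0)
    fun y _ => hΘ.continuousAt.eventually_ne (hx y)
  exact this.mono fun x h y => h y (mem_univ y)

lemma isAddHaarMeasure_volume_real_prod {E : Type*} [AddGroup E] [TopologicalSpace E]
    [ContinuousAdd E] [MeasureTheory.MeasureSpace E] [MeasurableAdd E] [BorelSpace E]
    [SecondCountableTopology E]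
    [(MeasureTheory.volume : MeasureTheory.Measure E).IsAddHaarMeasure]
    [MeasureTheory.SigmaFinite (MeasureTheory.volume : MeasureTheory.Measure E)] :
    (MeasureTheory.volume : MeasureTheory.Measure (ℝ × E)).IsAddHaarMeasure :=
  inferInstanceAs ((MeasureTheory.volume : MeasureTheory.Measure ℝ).prod
    (MeasureTheory.volume : MeasureTheory.Measure E)).IsAddHaarMeasure

/-- Recorded as an instance because the instance search does not get through the nested products. -/
instance isAddHaarMeasure_volume_real_five :
    (MeasureTheory.volume : MeasureTheory.Measure (ℝ × ℝ × ℝ × ℝ × ℝ)).IsAddHaarMeasure := by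
  have h2 : (MeasureTheory.volume : MeasureTheory.Measure (ℝ × ℝ)).IsAddHaarMeasure :=
    isAddHaarMeasure_volume_real_prod
  have h3 : (MeasureTheory.volume : MeasureTheory.Measure (ℝ × ℝ × ℝ)).IsAddHaarMeasure :=
    isAddHaarMeasure_volume_real_prod
  have h4 : (MeasureTheory.volume : MeasureTheory.Measure (ℝ × ℝ × ℝ × ℝ)).IsAddHaarMeasure :=
    isAddHaarMeasure_volume_real_prod
  exact isAddHaarMeasure_volume_real_prod

/-- The graph of a measurable function of the first four coordinates is a null set. -/
lemma volume_graph_eq_zero {g : ℝ × ℝ × ℝ × ℝ → ℝ} (hg : Measurable g) :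
    MeasureTheory.volume {w : ℝ × ℝ × ℝ × ℝ × ℝ |
      w.2.2.2.2 = g (w.1, w.2.1, w.2.2.1, w.2.2.2.1)} = 0 := by
  have hm : MeasurableSet {w : ℝ × ℝ × ℝ × ℝ × ℝ |
      w.2.2.2.2 = g (w.1, w.2.1, w.2.2.1, w.2.2.2.1)} :=
    measurableSet_eq_fun (by fun_prop) (hg.comp (by fun_prop))
  rw [MeasureTheory.Measure.volume_eq_prod, MeasureTheory.Measure.measure_prod_null hm]
  refine Eventually.of_forall fun a => ?_
  have hm := measurable_prodMk_left (x := a) hm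
  rw [MeasureTheory.Measure.volume_eq_prod, Pi.zero_apply,
    MeasureTheory.Measure.measure_prod_null hm]
  refine Eventually.of_forall fun b => ?_
  have hm := measurable_prodMk_left (x := b) hm
  rw [MeasureTheory.Measure.volume_eq_prod, Pi.zero_apply,
    MeasureTheory.Measure.measure_prod_null hm]
  refine Eventually.of_forall fun c => ?_
  have hm := measurable_prodMk_left (x := c) hm
  rw [MeasureTheory.Measure.volume_eq_prod, Pi.zero_apply,
    MeasureTheory.Measure.measure_prod_null hm]
  refine Eventually.of_forall fun d => ?_
  exact Real.volume_singleton (a := g (a, b, c, d))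

/-- The graph condition on the fourth coordinate also gives a null set. -/
lemma volume_graph_eq_zero' {g : ℝ × ℝ × ℝ → ℝ} (hg : Measurable g) :
    MeasureTheory.volume {w : ℝ × ℝ × ℝ × ℝ × ℝ |
      w.2.2.2.1 = g (w.1, w.2.1, w.2.2.1)} = 0 := by
  have hm : MeasurableSet {w : ℝ × ℝ × ℝ × ℝ × ℝ | w.2.2.2.1 = g (w.1, w.2.1, w.2.2.1)} :=
    measurableSet_eq_fun (by fun_prop) (hg.comp (by fun_prop))
  rw [MeasureTheory.Measure.volume_eq_prod, MeasureTheory.Measure.measure_prod_null hm]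
  refine Eventually.of_forall fun a => ?_
  have hm := measurable_prodMk_left (x := a) hm
  rw [MeasureTheory.Measure.volume_eq_prod, Pi.zero_apply,
    MeasureTheory.Measure.measure_prod_null hm]
  refine Eventually.of_forall fun b => ?_
  have hm := measurable_prodMk_left (x := b) hm
  rw [MeasureTheory.Measure.volume_eq_prod, Pi.zero_apply,
    MeasureTheory.Measure.measure_prod_null hm]
  refine Eventually.of_forall fun c => ?_
  have : (Prod.mk c ⁻¹' (Prod.mk b ⁻¹' (Prod.mk a ⁻¹'
      {w : ℝ × ℝ × ℝ × ℝ × ℝ | w.2.2.2.1 = g (w.1, w.2.1, w.2.2.1)}))) =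
      {g (a, b, c)} ×ˢ (univ : Set ℝ) := by
    ext ⟨x, y⟩; simp
  change MeasureTheory.volume _ = 0
  rw [this, MeasureTheory.Measure.volume_eq_prod, MeasureTheory.Measure.prod_prod,
    Real.volume_singleton, zero_mul]

namespace SectionMap

variable {k : ℕ∞}

/-- The functions all of whose zeros of the Schwarzian derivative are simple and satisfy the
nondegeneracy condition of the model. -/
def nondegenerateFlips (k : ℕ∞) : Set (SectionMap k) :=
  {f | ∀ y ∈ Icc (-1 : ℝ) 1, schwarzianNum (f.jet y) = 0 →
    schwarzianNumDeriv (f.jet y) ≠ 0 ∧ flipFoldNum (f.jet y) ≠ 0}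

lemma natCast_le_of_five_le (hk : 5 ≤ k) {j : ℕ} (hj : j ≤ 5) : (j : ℕ∞) ≤ k :=
  le_trans (by exact_mod_cast hj) hk

lemma isOpen_nondegenerateFlips (hk : 5 ≤ k) : IsOpen (nondegenerateFlips k) := by
  have hc : ∀ j ≤ 5, Continuous fun v : SectionMap k × Icc (-1 : ℝ) 1 => v.1.jet v.2 j :=
    fun j hj => continuous_jet (natCast_le_of_five_le hk hj)
  have h1 := hc 1 (by norm_num)
  have h2 := hc 2 (by norm_num)
  have h3 := hc 3 (by norm_num)
  have h4 := hc 4 (by norm_num)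
  have h5 := hc 5 (by norm_num)
  have := isOpen_forall_ne_zero (X := SectionMap k) (Y := Icc (-1 : ℝ) 1)
    (Θ := fun v => (schwarzianNum (v.1.jet v.2),
      schwarzianNumDeriv (v.1.jet v.2) * flipFoldNum (v.1.jet v.2))) (by
      unfold schwarzianNum schwarzianNumDeriv flipFoldNum; fun_prop)
  convert! this using 1
  ext f
  simp only [nondegenerateFlips, mem_ofPred_eq, Subtype.forall, ne_eq, Prod.mk_eq_zero, mul_eq_zero,
    not_and, not_or]

/-- Adding a polynomial of degree at most five without constant term and with small coefficients
`a`, and its effect on the derivatives. -/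
lemma exists_polynomial_perturbation {f : SectionMap k} (hk : 5 ≤ k) {V : Set (SectionMap k)}
    (hV : V ∈ 𝓝 f) : ∀ᶠ a in 𝓝 (0 : ℝ × ℝ × ℝ × ℝ × ℝ), ∃ g ∈ V, ∀ y ∈ Icc (-1 : ℝ) 1,
      g.jet y 1 = f.jet y 1 + (a.1 + 2 * a.2.1 * y + 3 * a.2.2.1 * y ^ 2 +
        4 * a.2.2.2.1 * y ^ 3 + 5 * a.2.2.2.2 * y ^ 4) ∧
      g.jet y 2 = f.jet y 2 + (2 * a.2.1 + 6 * a.2.2.1 * y +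
        12 * a.2.2.2.1 * y ^ 2 + 20 * a.2.2.2.2 * y ^ 3) ∧
      g.jet y 3 = f.jet y 3 + (6 * a.2.2.1 + 24 * a.2.2.2.1 * y + 60 * a.2.2.2.2 * y ^ 2) ∧
      g.jet y 4 = f.jet y 4 + (24 * a.2.2.2.1 + 120 * a.2.2.2.2 * y) ∧
      g.jet y 5 = f.jet y 5 + 120 * a.2.2.2.2 := by
  set u : Fin 5 → ℝ → ℝ := fun i x => x ^ ((i : ℕ) + 1) with hu
  set c : ℝ × ℝ × ℝ × ℝ × ℝ → Fin 5 → ℝ := fun a => ![a.1, a.2.1, a.2.2.1, a.2.2.2.1, a.2.2.2.2]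
    with hc
  have huc : ∀ i, ContDiffOn ℝ k (u i) (Icc (-1) 1) := fun i => by
    simp only [hu]; exact (contDiff_id.pow _).contDiffOn
  have hct : Tendsto c (𝓝 0) (𝓝 0) := by
    rw [tendsto_pi_nhds]
    intro i
    have : Continuous fun a => c a i := by
      fin_cases i <;> simp [hc] <;> fun_prop
    convert! this.tendsto 0 using 2
    fin_cases i <;> simp [hc]
  filter_upwards [eventually_exists_add_sum_mem (le_trans (by norm_num) hk) hV huc hct]
    with a ⟨g, hg, hgf⟩
  refine ⟨g, hg, fun y hy => ?_⟩
  have key : ∀ j ≤ 5, g.jet y j = f.jet y j + ∑ i : Fin 5, c a i *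
      ((((i : ℕ) + 1).descFactorial j : ℕ) * y ^ ((i : ℕ) + 1 - j)) := by
    intro j hj
    have h1 := iteratedDerivWithin_add_sum f huc (c a) (natCast_le_of_five_le hk hj) hy
    rw [← hgf] at h1
    change g.jet y j = _ at h1
    rw [h1]
    congr 1
    refine Finset.sum_congr rfl fun i _ => ?_
    rw [hu, iteratedDerivWithin_pow hy uniqueDiffOn]
  refine ⟨?_, ?_, ?_, ?_, ?_⟩
  · rw [key 1 (by norm_num)]; simp [Fin.sum_univ_five, hc, Nat.descFactorial]; ring
  · rw [key 2 (by norm_num)]; simp [Fin.sum_univ_five, hc, Nat.descFactorial]; ring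
  · rw [key 3 (by norm_num)]; simp [Fin.sum_univ_five, hc, Nat.descFactorial]; ring
  · rw [key 4 (by norm_num)]; simp [Fin.sum_univ_five, hc, Nat.descFactorial]; ring
  · rw [key 5 (by norm_num)]; simp [Fin.sum_univ_five, hc, Nat.descFactorial]; ring

/-- The coefficients `a` for which the perturbed function has a degenerate flip are the image of a
null set of tuples `(y, f', f'', f⁗, a₅)` under a differentiable map: a polynomial of degree five
without constant term is determined by its derivatives of order `1, …, 5` at `y`. -/
lemma exists_null_set_of_degenerateFlip (f : SectionMap k) (hk : 5 ≤ k) :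
    ∃ B : Set (ℝ × ℝ × ℝ × ℝ × ℝ), MeasureTheory.volume B = 0 ∧
      ∀ a : ℝ × ℝ × ℝ × ℝ × ℝ, ∀ y ∈ Icc (-1 : ℝ) 1, ∀ J : ℕ → ℝ, 0 < J 1 →
      J 1 = f.jet y 1 + (a.1 + 2 * a.2.1 * y + 3 * a.2.2.1 * y ^ 2 +
        4 * a.2.2.2.1 * y ^ 3 + 5 * a.2.2.2.2 * y ^ 4) →
      J 2 = f.jet y 2 + (2 * a.2.1 + 6 * a.2.2.1 * y +
        12 * a.2.2.2.1 * y ^ 2 + 20 * a.2.2.2.2 * y ^ 3) →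
      J 3 = f.jet y 3 + (6 * a.2.2.1 + 24 * a.2.2.2.1 * y + 60 * a.2.2.2.2 * y ^ 2) →
      J 4 = f.jet y 4 + (24 * a.2.2.2.1 + 120 * a.2.2.2.2 * y) →
      J 5 = f.jet y 5 + 120 * a.2.2.2.2 →
      schwarzianNum J = 0 → (schwarzianNumDeriv J = 0 ∨ flipFoldNum J = 0) → a ∈ B := by
  obtain ⟨f₅, hf₅, hf₅e⟩ := exists_continuous_eqOn_Icc (by norm_num)
    (f.continuousOn_jet (natCast_le_of_five_le hk le_rfl))
  set g₁ : ℝ × ℝ × ℝ → ℝ := fun v => 3 * v.2.2 ^ 3 / v.2.1 ^ 2 with hg₁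
  set g₂ : ℝ × ℝ × ℝ × ℝ → ℝ := fun v => ((15 * v.2.1 ^ 2 * v.2.2.1 * v.2.2.2 -
    30 * v.2.2.1 ^ 4) / (2 * v.2.1 ^ 3) - f₅ v.1) / 120 with hg₂
  set s₁ : Set (ℝ × ℝ × ℝ × ℝ × ℝ) := {w | w.2.2.2.1 = g₁ (w.1, w.2.1, w.2.2.1)} with hs₁
  set s₂ : Set (ℝ × ℝ × ℝ × ℝ × ℝ) :=
    {w | w.2.2.2.2 = g₂ (w.1, w.2.1, w.2.2.1, w.2.2.2.1)} with hs₂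
  have hs₁0 : MeasureTheory.volume s₁ = 0 := volume_graph_eq_zero' (by simp only [hg₁]; fun_prop)
  have hs₂0 : MeasureTheory.volume s₂ = 0 := volume_graph_eq_zero
    (by have := hf₅.measurable; simp only [hg₂]; fun_prop)
  set s : Set (ℝ × ℝ × ℝ × ℝ × ℝ) := (s₁ ∪ s₂) ∩ {w | w.1 ∈ Icc (-1 : ℝ) 1 ∧ 0 < w.2.1} with hs
  have hs0 : MeasureTheory.volume s = 0 :=
    MeasureTheory.measure_mono_null inter_subset_left (MeasureTheory.measure_union_null hs₁0 hs₂0)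
  set A₄ : ℝ × ℝ × ℝ × ℝ × ℝ → ℝ := fun w =>
    (w.2.2.2.1 - f.jet w.1 4 - 120 * w.2.2.2.2 * w.1) / 24 with hA₄
  set A₃ : ℝ × ℝ × ℝ × ℝ × ℝ → ℝ := fun w =>
    (3 * w.2.2.1 ^ 2 / (2 * w.2.1) - f.jet w.1 3 - 24 * A₄ w * w.1 - 60 * w.2.2.2.2 * w.1 ^ 2) / 6
    with hA₃
  set A₂ : ℝ × ℝ × ℝ × ℝ × ℝ → ℝ := fun w =>
    (w.2.2.1 - f.jet w.1 2 - 6 * A₃ w * w.1 - 12 * A₄ w * w.1 ^ 2 - 20 * w.2.2.2.2 * w.1 ^ 3) / 2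
    with hA₂
  set A₁ : ℝ × ℝ × ℝ × ℝ × ℝ → ℝ := fun w =>
    w.2.1 - f.jet w.1 1 - 2 * A₂ w * w.1 - 3 * A₃ w * w.1 ^ 2 - 4 * A₄ w * w.1 ^ 3 -
      5 * w.2.2.2.2 * w.1 ^ 4 with hA₁
  have hjd : ∀ j ≤ 4, DifferentiableOn ℝ (fun w : ℝ × ℝ × ℝ × ℝ × ℝ => f.jet w.1 j) s := by
    intro j hj
    have h1 : DifferentiableOn ℝ (fun y => f.jet y j) (Icc (-1) 1) := fun y hy =>
      (f.hasDerivWithinAt_jet (natCast_le_of_five_le hk (by omega)) hy).differentiableWithinAt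
    exact h1.comp (by fun_prop) fun w hw => hw.2.1
  have d1 := hjd 1 (by norm_num)
  have d2 := hjd 2 (by norm_num)
  have d3 := hjd 3 (by norm_num)
  have d4 := hjd 4 (by norm_num)
  have e4 : DifferentiableOn ℝ A₄ s := by simp only [hA₄]; fun_prop
  have e0 : DifferentiableOn ℝ (fun w : ℝ × ℝ × ℝ × ℝ × ℝ => 3 * w.2.2.1 ^ 2 / (2 * w.2.1)) s := by
    intro w hw
    have h0 : 2 * w.2.1 ≠ 0 := by
      have := hw.2.2
      positivity
    exact DifferentiableAt.differentiableWithinAt (by fun_prop (disch := assumption))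
  have e3 : DifferentiableOn ℝ A₃ s := by simp only [hA₃]; fun_prop
  have e2 : DifferentiableOn ℝ A₂ s := by simp only [hA₂]; fun_prop
  have e1 : DifferentiableOn ℝ A₁ s := by simp only [hA₁]; fun_prop
  have hΨ : DifferentiableOn ℝ (fun w => (A₁ w, A₂ w, A₃ w, A₄ w, w.2.2.2.2)) s :=
    e1.prodMk (e2.prodMk (e3.prodMk (e4.prodMk (by fun_prop))))
  refine ⟨_, MeasureTheory.addHaar_image_eq_zero_of_differentiableOn_of_addHaar_eq_zero
    MeasureTheory.volume hΨ hs0, ?_⟩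
  rintro ⟨a₁, a₂, a₃, a₄, a₅⟩ y hy J hJ h1 h2 h3 h4 h5 hS hor
  simp only at h1 h2 h3 h4 h5
  have hJ3 : J 3 = 3 * J 2 ^ 2 / (2 * J 1) := by
    simp only [schwarzianNum] at hS
    field_simp
    linarith
  have q4 : A₄ (y, J 1, J 2, J 4, a₅) = a₄ := by simp only [hA₄]; linarith
  have q3 : A₃ (y, J 1, J 2, J 4, a₅) = a₃ := by simp only [hA₃, q4]; linarith
  have q2 : A₂ (y, J 1, J 2, J 4, a₅) = a₂ := by simp only [hA₂, q4, q3]; linarith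
  have q1 : A₁ (y, J 1, J 2, J 4, a₅) = a₁ := by simp only [hA₁, q4, q3, q2]; linarith
  refine ⟨(y, J 1, J 2, J 4, a₅), ⟨?_, hy, hJ⟩, by simp only [q1, q2, q3, q4]⟩
  rcases hor with h | h
  · left
    simp only [hs₁, hg₁, mem_ofPred_eq]
    simp only [schwarzianNumDeriv, hJ3] at h
    field_simp at h ⊢
    linarith
  · right
    simp only [hs₂, hg₂, mem_ofPred_eq, hf₅e hy]
    simp only [flipFoldNum, h5] at h
    field_simp
    linarith

lemma dense_nondegenerateFlips (hk : 5 ≤ k) : Dense (nondegenerateFlips k) := by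
  intro f
  rw [mem_closure_iff_nhds]
  intro V hV
  obtain ⟨B, hB0, hB⟩ := f.exists_null_set_of_degenerateFlip hk
  have hdense : Dense Bᶜ := MeasureTheory.Measure.dense_of_ae
    (μ := (MeasureTheory.volume : MeasureTheory.Measure (ℝ × ℝ × ℝ × ℝ × ℝ)))
    (p := fun a => a ∉ B) (MeasureTheory.measure_eq_zero_iff_ae_notMem.1 hB0)
  obtain ⟨a, ha, haB⟩ := mem_closure_iff_nhds.1 (hdense 0) _
    (exists_polynomial_perturbation hk hV)
  obtain ⟨g, hg, hgj⟩ := ha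
  refine ⟨g, hg, fun y hy hS => ?_⟩
  by_contra hcon
  obtain ⟨h1, h2, h3, h4, h5⟩ := hgj y hy
  exact haB (hB a y hy (g.jet y) (g.jet_one_pos hy) h1 h2 h3 h4 h5 hS (by tauto))

end SectionMap

/-! ### Flips are generically isolated from the other degenerate cycles -/

/-- The parameters with a degenerate cycle of period exactly two are the critical values of the map
sending `{y, z}` to the parameters for which it is a cycle. -/
lemma volume_degenerateCycles_eq_zero {f d : ℝ → ℝ} {K : Set ℝ}
    (hfd : ∀ y ∈ K, HasDerivWithinAt f (d y) K y) (hd : ∀ y ∈ K, 0 < d y) :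
    MeasureTheory.volume {x : ℝ × ℝ | ∃ y ∈ K, ∃ z ∈ K, y ≠ z ∧
      IsDegenerateCycle f d x.1 x.2 y z} = 0 := by
  set P : ℝ × ℝ → ℝ := fun w => (f w.1 - f w.2) * (w.1 - w.2)⁻¹ with hP
  set s : Set (ℝ × ℝ) := {w | w ∈ K ×ˢ K ∧ w.1 ≠ w.2 ∧ d w.1 * d w.2 = P w ^ 2} with hs
  have hsK : s ⊆ K ×ˢ K := fun w hw => hw.1
  have hex : ∀ w ∈ s, ∃ L : ℝ × ℝ →L[ℝ] ℝ × ℝ,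
      HasFDerivWithinAt (fun w => (P w, f w.1 + P w * w.2)) L s w ∧ L.det = 0 := by
    intro w hw
    have hne : w.1 - w.2 ≠ 0 := sub_ne_zero.2 hw.2.1
    have h1 : HasFDerivWithinAt (fun w : ℝ × ℝ => f w.1)
        (d w.1 • ContinuousLinearMap.fst ℝ ℝ ℝ) s w :=
      (hfd w.1 hw.1.1).comp_hasFDerivWithinAt w hasFDerivWithinAt_fst fun v hv => (hsK hv).1
    have h2 : HasFDerivWithinAt (fun w : ℝ × ℝ => f w.2)
        (d w.2 • ContinuousLinearMap.snd ℝ ℝ ℝ) s w :=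
      (hfd w.2 hw.1.2).comp_hasFDerivWithinAt w hasFDerivWithinAt_snd fun v hv => (hsK hv).2
    have h3 := (hasDerivAt_inv hne).comp_hasFDerivWithinAt w
      ((hasFDerivWithinAt_fst (𝕜 := ℝ) (E := ℝ) (F := ℝ) (p := w) (s := s)).sub
        hasFDerivWithinAt_snd)
    have h4 := (h1.sub h2).mul h3
    have h5 := h1.add (h4.mul (hasFDerivWithinAt_snd (𝕜 := ℝ) (E := ℝ) (F := ℝ)))
    refine ⟨_, h4.prodMk h5, ?_⟩
    refine LinearMap.det_eq_zero_iff_ker_ne_bot.2 fun hker => ?_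
    -- the parameters do not change to first order along the direction `(p, -f' y)`
    have hv : ((P w, -d w.1) : ℝ × ℝ) = 0 := by
      rw [← Submodule.mem_bot ℝ, ← hker, LinearMap.mem_ker]
      have h6 : d w.1 * d w.2 = P w ^ 2 := hw.2.2
      have h7 : (f w.1 - f w.2) = P w * (w.1 - w.2) := by simp only [hP]; field_simp
      ext
      · simp [h7]
        field_simp
        linear_combination h6
      · simp [h7]
        field_simp
        linear_combination w.2 * h6
    have := hd w.1 hw.1.1
    have h8 := congrArg Prod.snd hv
    simp only [Prod.snd_zero] at h8
    linarith
  choose! L hL hL0 using hex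
  refine MeasureTheory.measure_mono_null ?_
    (MeasureTheory.addHaar_image_eq_zero_of_det_fderivWithin_eq_zero MeasureTheory.volume hL hL0)
  rintro ⟨p, q⟩ ⟨y, hy, z, hz, hyz, h1, h2, h3⟩
  have hne : y - z ≠ 0 := sub_ne_zero.2 hyz
  have hPp : P (y, z) = p := by
    simp only [hP]; field_simp; linarith
  exact ⟨(y, z), ⟨⟨hy, hz⟩, hyz, by rw [hPp]; exact h3⟩, by simp only [hPp, h1]⟩

namespace SectionMap

variable {k : ℕ∞}

/-- The functions for which no flip in the closed ball of radius `r` about `c` has the same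
parameters as a degenerate cycle lying outside the ball of radius `4 r`. -/
def isolatedFlips (k : ℕ∞) (c r : ℝ) : Set (SectionMap k) :=
  {f | ∀ y₀ ∈ Icc (-1 : ℝ) 1, y₀ ∈ Metric.closedBall c r →
    ∀ y ∈ Icc (-1 : ℝ) 1, y ∉ Metric.ball c (4 * r) →
    ∀ z ∈ Icc (-1 : ℝ) 1, z ∉ Metric.ball c (4 * r) → schwarzianNum (f.jet y₀) = 0 →
    ¬ IsDegenerateCycle f.toFun (fun y => f.jet y 1) (f.jet y₀ 1)
      (f.jet y₀ 1 * y₀ + f.toFun y₀) y z}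

lemma isOpen_isolatedFlips (hk : 5 ≤ k) (c r : ℝ) : IsOpen (isolatedFlips k c r) := by
  set K : Set (Icc (-1 : ℝ) 1 × Icc (-1 : ℝ) 1 × Icc (-1 : ℝ) 1) :=
    {w | (w.1 : ℝ) ∈ Metric.closedBall c r ∧ (w.2.1 : ℝ) ∈ (Metric.ball c (4 * r))ᶜ ∧
      (w.2.2 : ℝ) ∈ (Metric.ball c (4 * r))ᶜ} with hK
  have hKc : IsClosed K := by
    have hb : IsClosed (Metric.ball c (4 * r))ᶜ := Metric.isOpen_ball.isClosed_compl
    exact (Metric.isClosed_closedBall.preimage (by fun_prop)).inter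
      ((hb.preimage (by fun_prop)).inter (hb.preimage (by fun_prop)))
  have : CompactSpace K := isCompact_iff_compactSpace.1 hKc.isCompact
  have hc : ∀ j ≤ 5, ∀ π : K → Icc (-1 : ℝ) 1, Continuous π →
      Continuous fun v : SectionMap k × K => v.1.jet (π v.2) j :=
    fun j hj π hπ => (continuous_jet (natCast_le_of_five_le hk hj)).comp
      (continuous_fst.prodMk (hπ.comp continuous_snd))
  have c0 : Continuous fun w : K => w.1.1 := by fun_prop
  have c1 : Continuous fun w : K => w.1.2.1 := by fun_prop
  have c2 : Continuous fun w : K => w.1.2.2 := by fun_prop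
  have a0 := hc 0 (by norm_num) _ c0
  have a1 := hc 1 (by norm_num) _ c0
  have a2 := hc 2 (by norm_num) _ c0
  have a3 := hc 3 (by norm_num) _ c0
  have b0 := hc 0 (by norm_num) _ c1
  have b1 := hc 1 (by norm_num) _ c1
  have d0 := hc 0 (by norm_num) _ c2
  have d1 := hc 1 (by norm_num) _ c2
  have := isOpen_forall_ne_zero (X := SectionMap k) (Y := K)
    (Θ := fun v => (schwarzianNum (v.1.jet v.2.1.1),
      v.1.jet v.2.1.2.1 0 + v.1.jet v.2.1.1 1 * v.2.1.2.2 -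
        (v.1.jet v.2.1.1 1 * v.2.1.1 + v.1.jet v.2.1.1 0),
      v.1.jet v.2.1.2.2 0 + v.1.jet v.2.1.1 1 * v.2.1.2.1 -
        (v.1.jet v.2.1.1 1 * v.2.1.1 + v.1.jet v.2.1.1 0),
      v.1.jet v.2.1.2.1 1 * v.1.jet v.2.1.2.2 1 - v.1.jet v.2.1.1 1 ^ 2)) (by
      unfold schwarzianNum; fun_prop)
  convert! this using 1
  ext f
  simp only [isolatedFlips, IsDegenerateCycle, hK, mem_ofPred_eq, Subtype.forall, Prod.forall,
    ne_eq, Prod.mk_eq_zero, sub_eq_zero, jet_zero, mem_compl_iff]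
  constructor
  · rintro h y₀ hy₀ y hy z hz ⟨h1, h2, h3⟩ ⟨hS, h4⟩
    exact h y₀ hy₀ h1 y hy h2 z hz h3 hS h4
  · intro h y₀ hy₀ h1 y hy h2 z hz h3 hS h4
    exact h y₀ hy₀ y hy z hz ⟨h1, h2, h3⟩ ⟨hS, h4⟩

lemma strictMonoOn (f : SectionMap k) (hk : 5 ≤ k) : StrictMonoOn f.toFun (Icc (-1) 1) := by
  refine strictMonoOn_of_hasDerivWithinAt_pos (f' := fun y => f.jet y 1) (convex_Icc _ _)
    f.contDiffOn.continuousOn (fun y hy => ?_) fun y hy => f.jet_one_pos (interior_subset hy)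
  have := f.hasDerivWithinAt_jet (j := 0) (natCast_le_of_five_le hk (by norm_num))
    (interior_subset hy)
  simp only [jet_zero, zero_add] at this
  exact this.mono interior_subset

/-- Flips of a function with nondegenerate flips are isolated from each other. -/
lemma finite_flips {f : SectionMap k} (hk : 5 ≤ k) (hf : f ∈ nondegenerateFlips k) :
    {y | y ∈ Icc (-1 : ℝ) 1 ∧ schwarzianNum (f.jet y) = 0}.Finite := by
  by_contra hinf
  obtain ⟨x, hx, hacc⟩ := Set.Infinite.exists_accPt_of_subset_isCompact hinf
    (isCompact_Icc (a := (-1 : ℝ)) (b := 1)) fun y hy => hy.1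
  have hd : ∀ j ≤ 4, HasDerivWithinAt (fun y => f.jet y j) (f.jet x (j + 1)) (Icc (-1) 1) x :=
    fun j hj => f.hasDerivWithinAt_jet (natCast_le_of_five_le hk (by omega)) hx
  have hS : HasDerivWithinAt (fun y => schwarzianNum (f.jet y)) (schwarzianNumDeriv (f.jet x))
      (Icc (-1) 1) x := by
    have := (((hd 1 (by norm_num)).const_mul 2).mul (hd 3 (by norm_num))).sub
      (((hd 2 (by norm_num)).pow 2).const_mul 3)
    convert! this using 1
    simp only [schwarzianNumDeriv]
    norm_num
    ring
  have hne : ∀ᶠ y in 𝓝[Icc (-1) 1 \ {x}] x, schwarzianNum (f.jet y) ≠ 0 := by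
    by_cases h0 : schwarzianNum (f.jet x) = 0
    · exact hS.eventually_ne (hf x hx h0).1
    · exact (hS.continuousWithinAt.mono sdiff_subset).eventually_ne h0
  rw [accPt_iff_frequently_nhdsNE] at hacc
  refine hacc ?_
  rw [sdiff_eq, inter_comm, nhdsWithin_inter', eventually_inf_principal] at hne
  filter_upwards [hne] with y hy hy'
  exact hy hy'.1 hy'.2

/-- Rescaling `f` and adding a constant near the ball of radius `r`, without changing it outside
the ball of radius `4 r`. -/
lemma exists_local_rescaling {f : SectionMap k} (hk : 5 ≤ k) {V : Set (SectionMap k)}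
    (hV : V ∈ 𝓝 f) (c : ℝ) {r : ℝ} (hr : 0 < r) : ∀ᶠ a in 𝓝 (0 : ℝ × ℝ), ∃ g ∈ V,
      (∀ y ∈ Icc (-1 : ℝ) 1, y ∈ Metric.closedBall c r →
        g.toFun y = (1 + a.1) * f.toFun y + a.2 ∧ ∀ j, 0 < j → g.jet y j = (1 + a.1) * f.jet y j) ∧
      (∀ y ∈ Icc (-1 : ℝ) 1, y ∉ Metric.ball c (4 * r) → ∀ j, g.jet y j = f.jet y j) := by
  let χ : ContDiffBump c := ⟨2 * r, 3 * r, by linarith, by linarith⟩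
  set u : Fin 2 → ℝ → ℝ := ![fun x => χ x * f.toFun x, χ] with hu
  have huc : ∀ i, ContDiffOn ℝ k (u i) (Icc (-1) 1) := by
    have h1 : ContDiffOn ℝ k χ (Icc (-1) 1) := χ.contDiff.contDiffOn
    intro i
    fin_cases i
    · exact h1.mul f.contDiffOn
    · exact h1
  have hct : Tendsto (fun a : ℝ × ℝ => ![a.1, a.2]) (𝓝 0) (𝓝 0) := by
    rw [tendsto_pi_nhds]
    intro i
    fin_cases i
    · exact continuous_fst.tendsto (0 : ℝ × ℝ)
    · exact continuous_snd.tendsto (0 : ℝ × ℝ)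
  filter_upwards [eventually_exists_add_sum_mem (le_trans (by norm_num) hk) hV huc hct]
    with a ⟨g, hg, hgf⟩
  have hgf' : ∀ x, g.toFun x = f.toFun x + (a.1 * (χ x * f.toFun x) + a.2 * χ x) := fun x => by
    rw [hgf]; simp [hu, Fin.sum_univ_two]
  refine ⟨g, hg, fun y hy hyc => ?_, fun y hy hyc j => ?_⟩
  · have hy2 : y ∈ Metric.ball c (2 * r) := Metric.closedBall_subset_ball (by linarith) hyc
    have heq : g.toFun =ᶠ[𝓝 y] fun x => a.2 + (1 + a.1) * f.toFun x := by
      filter_upwards [Metric.isOpen_ball.mem_nhds hy2] with x hx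
      rw [hgf', χ.one_of_mem_closedBall (Metric.ball_subset_closedBall hx)]
      ring
    refine ⟨by rw [heq.eq_of_nhds]; ring, fun j hj => ?_⟩
    rw [jet, (heq.filter_mono nhdsWithin_le_nhds).iteratedDerivWithin_eq heq.eq_of_nhds,
      iteratedDerivWithin_const_add hj, iteratedDerivWithin_const_mul_field]
    rfl
  · have hy3 : y ∈ (Metric.closedBall c (3 * r))ᶜ := fun h =>
      hyc (Metric.closedBall_subset_ball (by linarith) h)
    have heq : g.toFun =ᶠ[𝓝 y] f.toFun := by
      filter_upwards [Metric.isClosed_closedBall.isOpen_compl.mem_nhds hy3] with x hx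
      have h0 : χ x = 0 := χ.zero_of_le_dist
        (le_of_lt (by simpa only [mem_compl_iff, Metric.mem_closedBall, not_le] using hx))
      rw [hgf', h0]
      ring
    exact (heq.filter_mono nhdsWithin_le_nhds).iteratedDerivWithin_eq heq.eq_of_nhds

lemma dense_isolatedFlips (hk : 5 ≤ k) (c : ℝ) {r : ℝ} (hr : 0 < r) :
    Dense (isolatedFlips k c r) := by
  intro f₀
  rw [mem_closure_iff_nhds]
  intro V hV
  obtain ⟨f, hfV, hf⟩ := mem_closure_iff_nhds.1 (dense_nondegenerateFlips hk f₀) _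
    (interior_mem_nhds.2 hV)
  set C : Set (ℝ × ℝ) := {x | ∃ y ∈ Icc (-1 : ℝ) 1, ∃ z ∈ Icc (-1 : ℝ) 1, y ≠ z ∧
    IsDegenerateCycle f.toFun (fun y => f.jet y 1) x.1 x.2 y z} with hC
  have hC0 : MeasureTheory.volume C = 0 := by
    refine volume_degenerateCycles_eq_zero (fun y hy => ?_) fun y hy => f.jet_one_pos hy
    have := f.hasDerivWithinAt_jet (j := 0) (natCast_le_of_five_le hk (by norm_num)) hy
    simpa only [jet_zero, zero_add] using this
  set Z : Set ℝ := {y | y ∈ Icc (-1 : ℝ) 1 ∧ schwarzianNum (f.jet y) = 0} with hZ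
  -- the rescaling which moves the parameters of the flip `y₀` to `x`
  set T : ℝ → ℝ × ℝ → ℝ × ℝ := fun y₀ x => (x.1 / f.jet y₀ 1 - 1,
    x.2 - x.1 / f.jet y₀ 1 * (f.jet y₀ 1 * y₀ + f.toFun y₀)) with hT
  set B : Set (ℝ × ℝ) := ⋃ y₀ ∈ Z, T y₀ '' C with hB
  have hB0 : MeasureTheory.volume B = 0 := by
    rw [hB, MeasureTheory.measure_biUnion_null_iff (finite_flips hk hf).countable]
    intro y₀ _
    refine MeasureTheory.addHaar_image_eq_zero_of_differentiableOn_of_addHaar_eq_zero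
      MeasureTheory.volume ?_ hC0
    simp only [hT]
    fun_prop
  have hdense : Dense Bᶜ := MeasureTheory.Measure.dense_of_ae
    (μ := (MeasureTheory.volume : MeasureTheory.Measure (ℝ × ℝ)))
    (p := fun a => a ∉ B) (MeasureTheory.measure_eq_zero_iff_ae_notMem.1 hB0)
  obtain ⟨a, ⟨g, hg, hin, hout⟩, haB⟩ := mem_closure_iff_nhds.1 (hdense 0) _
    (exists_local_rescaling hk (mem_interior_iff_mem_nhds.1 hfV) c hr)
  refine ⟨g, hg, fun y₀ hy₀ hy₀c y hy hyc z hz hzc hS hcyc => haB ?_⟩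
  obtain ⟨hg0, hgj⟩ := hin y₀ hy₀ hy₀c
  have hp₁ := f.jet_one_pos hy₀
  have hp := g.jet_one_pos hy₀
  have hyz : y ≠ z := by
    rintro rfl
    obtain ⟨h1, -, h3⟩ := hcyc
    have h4 : g.jet y 1 = g.jet y₀ 1 := by
      have := g.jet_one_pos hy
      nlinarith
    have hy0 : y = y₀ := by
      by_contra hne
      rcases lt_or_gt_of_ne hne with hlt | hlt
      · have := g.strictMonoOn hk hy hy₀ hlt
        nlinarith
      · have := g.strictMonoOn hk hy₀ hy hlt
        nlinarith
    exact hyc (hy0 ▸ Metric.closedBall_subset_ball (by linarith) hy₀c)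
  have hg1 := hgj 1 (by norm_num)
  have ha : 1 + a.1 ≠ 0 := by
    intro h
    rw [hg1, h, zero_mul] at hp
    exact lt_irrefl _ hp
  have hy₀Z : y₀ ∈ Z := by
    refine ⟨hy₀, ?_⟩
    have : (1 + a.1) ^ 2 * schwarzianNum (f.jet y₀) = 0 := by
      rw [← hS]
      simp only [schwarzianNum, hg1, hgj 2 (by norm_num), hgj 3 (by norm_num)]
      ring
    exact (mul_eq_zero.1 this).resolve_left (pow_ne_zero 2 ha)
  rw [hB]
  refine mem_biUnion hy₀Z ⟨(g.jet y₀ 1, g.jet y₀ 1 * y₀ + g.toFun y₀), ⟨y, hy, z, hz, hyz, ?_⟩, ?_⟩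
  · obtain ⟨h1, h2, h3⟩ := hcyc
    simp only [← jet_zero] at h1 h2 ⊢
    simp only [hout y hy hyc, hout z hz hzc] at h1 h2 h3
    exact ⟨by rw [← jet_zero]; exact h1, by rw [← jet_zero]; exact h2, h3⟩
  · have hdiv : g.jet y₀ 1 / f.jet y₀ 1 = 1 + a.1 := by rw [hg1]; field_simp
    simp only [hT, hdiv]
    ext
    · ring
    · simp only [hg0, hg1]; ring

end SectionMap

/-! ### Generic functions -/

lemma iteratedDerivWithin_eq_of_isJet {f : ℝ → ℝ} {F : ℕ → ℝ → ℝ} (hF : IsJet F) {y₀ : ℝ}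
    (hy₀ : y₀ ∈ Ioo (-1 : ℝ) 1) (hfF : f =ᶠ[𝓝 y₀] F 0) {j : ℕ} (hj : j ≤ 5) :
    iteratedDerivWithin j f (Icc (-1) 1) y₀ = F j y₀ := by
  have key : ∀ j ≤ 5, iteratedDeriv j (F 0) = F j := by
    intro j
    induction j with
    | zero => intro _; exact iteratedDeriv_zero
    | succ j ih =>
      intro hj
      rw [iteratedDeriv_succ, ih (by omega)]
      exact funext fun x => (hF.hasDerivAt j (by omega) x).deriv
  have h1 : iteratedDerivWithin j f (Icc (-1) 1) y₀ = iteratedDeriv j f y₀ := by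
    rw [← iteratedDerivWithin_univ, iteratedDerivWithin, iteratedDerivWithin,
      iteratedFDerivWithin_congr_set (eventuallyEq_univ.2 (Icc_mem_nhds hy₀.1 hy₀.2))]
  rw [h1, hfF.iteratedDeriv_eq, key j hj]

namespace SectionMap

variable {k : ℕ∞}

lemma eventually_residual_flips (hk : 5 ≤ k) : ∀ᶠ f : SectionMap k in residual (SectionMap k),
    f ∈ nondegenerateFlips k ∧ ∀ c r : ℚ, 0 < r → f ∈ isolatedFlips k c r := by
  refine Eventually.and (residual_of_dense_open (isOpen_nondegenerateFlips hk)
    (dense_nondegenerateFlips hk)) ?_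
  simp only [eventually_countable_forall]
  exact fun c r hr => residual_of_dense_open (isOpen_isolatedFlips hk c r)
    (dense_isolatedFlips hk c (by exact_mod_cast hr))

/-- If `f` has no flip sharing its parameters with a degenerate cycle far away, the fixed point is
the only degenerate cycle at the parameters of a flip. -/
lemma eq_of_isDegenerateCycle {f : SectionMap k}
    (hf : ∀ c r : ℚ, 0 < r → f ∈ isolatedFlips k c r) {y₀ : ℝ} (hy₀ : y₀ ∈ Icc (-1 : ℝ) 1)
    (hS : schwarzianNum (f.jet y₀) = 0) {y z : ℝ} (hy : y ∈ Icc (-1 : ℝ) 1)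
    (hz : z ∈ Icc (-1 : ℝ) 1) (h : IsDegenerateCycle f.toFun (fun y => f.jet y 1) (f.jet y₀ 1)
      (f.jet y₀ 1 * y₀ + f.toFun y₀) y z) : y = z := by
  by_contra hyz
  have hp := f.jet_one_pos hy₀
  have hy0 : y ≠ y₀ := by
    rintro rfl
    exact hyz (mul_left_cancel₀ hp.ne' (by linarith [h.1]))
  have hz0 : z ≠ y₀ := by
    rintro rfl
    exact hyz (mul_left_cancel₀ hp.ne' (by linarith [h.2.1]))
  obtain ⟨r, hr0, hr⟩ : ∃ r : ℚ, (0 : ℝ) < r ∧ (r : ℝ) < min |y - y₀| |z - y₀| / 5 :=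
    exists_rat_btwn (div_pos (lt_min (abs_pos.2 (sub_ne_zero.2 hy0))
      (abs_pos.2 (sub_ne_zero.2 hz0))) (by norm_num))
  obtain ⟨c, hc1, hc2⟩ := exists_rat_btwn (show y₀ < y₀ + r by linarith)
  have hcr : |y₀ - c| ≤ r := abs_le.2 ⟨by linarith, by linarith⟩
  have far : ∀ x, 5 * (r : ℝ) < |x - y₀| → x ∉ Metric.ball (c : ℝ) (4 * r) := by
    intro x hx hxc
    rw [Metric.mem_ball, Real.dist_eq] at hxc
    have := abs_sub_le x c y₀
    rw [abs_sub_comm (c : ℝ)] at this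
    linarith
  have hr1 := min_le_left |y - y₀| |z - y₀|
  have hr2 := min_le_right |y - y₀| |z - y₀|
  exact hf c r (by exact_mod_cast hr0) y₀ hy₀ hcr y hy (far y (by linarith)) z hz
    (far z (by linarith)) hS h

end SectionMap

theorem proposition3 (k : ℕ∞) (hk : 5 ≤ k) :
    ∀ᶠ f : SectionMap k in residual (SectionMap k),
      ∀ y₀ ∈ flipSet f.toFun,
        ∃ h : OpenPartialHomeomorph (ℝ × ℝ) (ℝ × ℝ),
          curveLZero f.toFun y₀ ∈ h.source ∧
          h (curveLZero f.toFun y₀) = (0, 0) ∧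
          ContDiffOn ℝ 1 h h.source ∧
          ContDiffOn ℝ 1 h.symm h.target ∧
          (∀ U ∈ 𝓝 y₀, ∀ᶠ x in 𝓝 (curveLZero f.toFun y₀),
            x ∈ apparentContour (phiZeroDomain f.toFun) (phiZero f.toFun) U ↔
              h x ∈ apparentContour univ flipModel univ) ∧
          (∀ᶠ x in 𝓝 (curveLZero f.toFun y₀),
            x ∈ curveLZero f.toFun '' Ioo (-1) 1 ↔ (h x).1 = 0) := by
  filter_upwards [SectionMap.eventually_residual_flips hk] with f hf y₀ hy₀
  have hy₀' : y₀ ∈ Icc (-1 : ℝ) 1 := Ioo_subset_Icc_self hy₀.1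
  have hle : ∀ {j : ℕ}, j ≤ 5 → (j : ℕ∞) ≤ k := SectionMap.natCast_le_of_five_le hk
  have hk' : ((5 : ℕ∞) : WithTop ℕ∞) ≤ k := WithTop.coe_le_coe.2 hk
  obtain ⟨F, hF, hfF⟩ := exists_isJet_eventuallyEq (f.contDiffOn.of_le hk') hy₀.1
  have hj : ∀ j ≤ 5, f.jet y₀ j = F j y₀ := fun j hj =>
    iteratedDerivWithin_eq_of_isJet hF hy₀.1 hfF hj
  have hp : 0 < F 1 y₀ := hj 1 (by norm_num) ▸ f.jet_one_pos hy₀'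
  have hN := schwarzian_eq_zero_of_mem_flipSet hF hfF hp hy₀
  have hS : schwarzianNum (f.jet y₀) = 0 := by
    simp only [schwarzianNum, hj 1 (by norm_num), hj 2 (by norm_num), hj 3 (by norm_num), hN]
  obtain ⟨hN', hC⟩ := hf.1 y₀ hy₀' hS
  simp only [schwarzianNumDeriv, flipFoldNum, hj 1 (by norm_num), hj 2 (by norm_num),
    hj 3 (by norm_num), hj 4 (by norm_num), hj 5 (by norm_num)] at hN' hC
  refine exists_flip_normalForm (d := fun y => f.jet y 1) f.contDiffOn.continuousOn
    (f.continuousOn_jet (hle (by norm_num))) (fun y hy => ?_) (fun y hy => f.jet_one_pos hy)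
    hy₀.1 hF hfF hN hN' hC fun y hy z hz h =>
      SectionMap.eq_of_isDegenerateCycle hf.2 hy₀' hS hy hz h
  have := f.hasDerivWithinAt_jet (j := 0) (hle (by norm_num)) (Ioo_subset_Icc_self hy)
  simp only [SectionMap.jet_zero, zero_add] at this
  exact this.hasDerivAt (Icc_mem_nhds hy.1 hy.2)
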